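/- Let $-\infty<a<b<\infty$, $1\le p\le\infty$, and let $m,r,l\ge 1$ and $n\ge 0$ be integers. Put $W_p^0:=L_p([a,b];\mathbb{C})$ and, for $q\ge 1$, $$W_p^q:=\{y\in C^{q-1}([a,b];\mathbb{C}) : y^{(q-1)} \text{ is absolutely continuous on } [a,b],\ y^{(q)}\in L_p\},\qquad \|y\|_{q,p}:=\sum_{i=0}^{q}\|y^{(i)}\|_{L_p}.$$ Let $A_0,\dots,A_{r-1}\in (W_p^n)^{m\times m}$, let $B\colon (W_p^{n+r})^m\to\mathbb{C}^l$ be a continuous linear operator, and put $$Ly:=y^{(r)}+\sum_{j=1}^{r}A_{r-j}\,y^{(r-j)},\qquad (L,B)\colon (W_p^{n+r})^m\to (W_p^n)^m\times\mathbb{C}^l,\quad y\mapsto (Ly,By).$$ For each $k\in\mathbb{N}$ let $A_{r-j}(\cdot,k)\in (W_p^n)^{m\times m}$ and a continuous linear operator $B(k)\colon (W_p^{n+r})^m\to\mathbb{C}^l$ be given, and let $(L(k),B(k))$ be the operator defined by them in the same way. Assume that $(L(k),B(k))$ converges strongly to $(L,B)$ as $k\to\infty$, that is, $(L(k)y,B(k)y)\to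 (Ly,By)$ in $(W_p^n)^m\times\mathbb{C}^l$ for every $y\in (W_p^{n+r})^m$. Then, for all sufficiently large $k$, $$\dim\ker(L(k),B(k))\le\dim\ker(L,B),\qquad \dim\operatorname{coker}(L(k),B(k))\le\dim\operatorname{coker}(L,B),$$ where the cokernel of an operator is the quotient of its target space by its range. In particular: 1. If $(L,B)$ is invertible (bijective with continuous inverse, $(L,B)$ itself being continuous), then the operators $(L(k),B(k))$ are also invertible for all sufficiently large $k$. 2. If the problem $Ly=f$, $By=c$ has a solution $y\in(W_p^{n+r})^m$ for all right-hand sides $f\in(W_p^n)^m$, $c\in\mathbb{C}^l$, then for all sufficiently large $k$ so does the problem $L(k)y=f$, $B(k)y=c$. 3. If the problem $Ly=f$, $By=c$ has exactly one solution for some right-hand side $(f,c)$, then for all sufficiently large $k$ the problem $L(k)y=f$, $B(k)y=c$ has at most one solution for every right-hand side; and if $Ly=f$, $By=c$ has exactly one solution for every right-hand side, then for all sufficiently large $k$ so does $L(k)y=f$, $B(k)y=c$. -/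

import Mathlib

open MeasureTheory Set Filter Topology
open scoped ENNReal

noncomputable section

namespace SobolevBVP

/-- Lebesgue measure on the interval `[a, b]`. -/
abbrev intervalMeasure (a b : ℝ) : Measure ℝ := volume.restrict (Icc a b)

/-- `IsSobolev a b p q y` : the function `y` belongs to `W_p^q([a, b]; ℂ)`. For `q = 0` this means
`y ∈ L_p`; for `q ≥ 1` it means that `y ∈ C^{q-1}[a, b]`, that `y^{(q-1)}` is absolutely continuous
on `[a, b]`, and that `y^{(q)}` (which then exists almost everywhere) is in `L_p`. -/
def IsSobolev (a b : ℝ) (p : ℝ≥0∞) : ℕ → (ℝ → ℂ) → Prop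
  | 0, y => MemLp y p (intervalMeasure a b)
  | q + 1, y => ContDiffOn ℝ q y (Icc a b) ∧
      AbsolutelyContinuousOnInterval (iteratedDerivWithin q y (Icc a b)) a b ∧
      MemLp (iteratedDerivWithin (q + 1) y (Icc a b)) p (intervalMeasure a b)

section helpers

variable {a b : ℝ} {p : ℝ≥0∞} {q : ℕ} {f g : ℝ → ℂ}

theorem ac_congr (hab : a < b) (h : EqOn f g (Icc a b))
    (hf : AbsolutelyContinuousOnInterval f a b) : AbsolutelyContinuousOnInterval g a b := by
  rw [absolutelyContinuousOnInterval_iff] at hf ⊢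
  intro ε hε
  obtain ⟨δ, hδ, H⟩ := hf ε hε
  refine ⟨δ, hδ, fun E hE hs => ?_⟩
  refine lt_of_eq_of_lt (Finset.sum_congr rfl fun i hi => ?_) (H E hE hs)
  have h1 := hE.1 i hi
  rw [uIcc_of_le hab.le] at h1
  rw [h h1.1, h h1.2]

theorem ae_of_forall_Icc {P : ℝ → Prop} (h : ∀ x ∈ Icc a b, P x) :
    ∀ᵐ x ∂(intervalMeasure a b), P x :=
  (ae_restrict_iff' measurableSet_Icc).2 (Eventually.of_forall h)

theorem ac_ae_diff (hab : a < b) (hf : AbsolutelyContinuousOnInterval f a b) :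
    ∀ᵐ x ∂(intervalMeasure a b), x ∈ Icc a b ∧ DifferentiableWithinAt ℝ f (Icc a b) x := by
  have h := hf.boundedVariationOn
  rw [uIcc_of_le hab.le] at h
  have h2 := h.locallyBoundedVariationOn.ae_differentiableWithinAt_of_mem
  filter_upwards [ae_restrict_of_ae h2, ae_restrict_mem measurableSet_Icc] with x hx hx'
  exact ⟨hx', hx hx'⟩

theorem memLp_of_continuousOn (hf : ContinuousOn f (Icc a b)) :
    MemLp f p (intervalMeasure a b) := by
  obtain ⟨C, hC⟩ := isCompact_Icc.exists_bound_of_continuousOn hf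
  exact MemLp.of_bound (hf.aestronglyMeasurable measurableSet_Icc) C (ae_of_forall_Icc hC)

theorem isSobolev_succ_succ (hab : a < b) :
    IsSobolev a b p (q + 2) f ↔
      DifferentiableOn ℝ f (Icc a b) ∧ IsSobolev a b p (q + 1) (derivWithin f (Icc a b)) := by
  have hu : UniqueDiffOn ℝ (Icc a b) := uniqueDiffOn_Icc hab
  have h1 : ContDiffOn ℝ ((q + 1 : ℕ) : WithTop ℕ∞) f (Icc a b) ↔
      DifferentiableOn ℝ f (Icc a b) ∧ ContDiffOn ℝ q (derivWithin f (Icc a b)) (Icc a b) := by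
    push_cast
    rw [contDiffOn_succ_iff_derivWithin hu]
    simp
  have h2 : ∀ k, iteratedDerivWithin (k + 1) f (Icc a b)
      = iteratedDerivWithin k (derivWithin f (Icc a b)) (Icc a b) := by
    intro k; funext x; rw [iteratedDerivWithin_succ']
  simp only [IsSobolev, h1, h2]
  tauto

theorem isSobolev_one : IsSobolev a b p 1 f ↔ ContinuousOn f (Icc a b) ∧
    AbsolutelyContinuousOnInterval f a b ∧
    MemLp (derivWithin f (Icc a b)) p (intervalMeasure a b) := by
  have h : iteratedDerivWithin 1 f (Icc a b) = derivWithin f (Icc a b) := by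
    funext x; simp
  simp [IsSobolev, h, contDiffOn_zero]

theorem IsSobolev.continuousOn (h : IsSobolev a b p (q + 1) f) : ContinuousOn f (Icc a b) :=
  h.1.continuousOn

theorem IsSobolev.ac (hab : a < b) (h : IsSobolev a b p (q + 1) f) :
    AbsolutelyContinuousOnInterval f a b := by
  cases q with
  | zero => exact (isSobolev_one.1 h).2.1
  | succ q =>
    have h1 : ContDiffOn ℝ 1 f (uIcc a b) := by
      rw [uIcc_of_le hab.le]
      exact h.1.of_le (by norm_cast; omega)
    exact h1.absolutelyContinuousOnInterval

theorem IsSobolev.congr (hab : a < b) (h : EqOn f g (Icc a b)) (hf : IsSobolev a b p q f) :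
    IsSobolev a b p q g := by
  cases q with
  | zero => exact MemLp.ae_eq (ae_of_forall_Icc h) hf
  | succ q =>
    exact ⟨hf.1.congr h.symm, ac_congr hab (iteratedDerivWithin_congr h) hf.2.1,
      MemLp.ae_eq (ae_of_forall_Icc (iteratedDerivWithin_congr h)) hf.2.2⟩

theorem isSobolev_zero_fun (hab : a < b) : IsSobolev a b p q (fun _ => 0) := by
  induction q with
  | zero => exact memLp_of_continuousOn continuousOn_const
  | succ q ih =>
    have h0 : derivWithin (fun _ : ℝ => (0 : ℂ)) (Icc a b) = fun _ => 0 := by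
      funext x; simp
    cases q with
    | zero =>
      refine isSobolev_one.2 ⟨continuousOn_const, ?_, ?_⟩
      · have h1 : ContDiffOn ℝ 1 (fun _ : ℝ => (0 : ℂ)) (uIcc a b) := contDiffOn_const
        exact h1.absolutelyContinuousOnInterval
      · rw [h0]; exact memLp_of_continuousOn continuousOn_const
    | succ q =>
      refine (isSobolev_succ_succ hab).2 ⟨differentiableOn_const _, ?_⟩
      rw [h0]; exact ih

theorem IsSobolev.add (hab : a < b) (hf : IsSobolev a b p q f) (hg : IsSobolev a b p q g) :
    IsSobolev a b p q (fun x => f x + g x) := by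
  induction q generalizing f g with
  | zero => exact MemLp.add hf hg
  | succ q ih =>
    cases q with
    | zero =>
      rw [isSobolev_one] at hf hg ⊢
      refine ⟨hf.1.add hg.1, hf.2.1.add hg.2.1, ?_⟩
      refine MemLp.ae_eq ?_ (hf.2.2.add hg.2.2)
      filter_upwards [ac_ae_diff hab hf.2.1, ac_ae_diff hab hg.2.1] with x h1 h2
      exact (derivWithin_fun_add h1.2 h2.2).symm
    | succ q =>
      rw [isSobolev_succ_succ hab] at hf hg ⊢
      exact ⟨hf.1.add hg.1, (ih hf.2 hg.2).congr hab fun x hx =>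
        (derivWithin_fun_add (hf.1 x hx) (hg.1 x hx)).symm⟩

theorem IsSobolev.sum (hab : a < b) {ι : Type*} (s : Finset ι) {F : ι → ℝ → ℂ}
    (hF : ∀ i ∈ s, IsSobolev a b p q (F i)) : IsSobolev a b p q (fun x => ∑ i ∈ s, F i x) := by
  classical
  induction s using Finset.induction_on with
  | empty => simpa using isSobolev_zero_fun hab
  | insert i s hi ih =>
    simp only [Finset.sum_insert hi]
    exact IsSobolev.add hab (hF i (by simp)) (ih fun j hj => hF j (by simp [hj]))

/-- The `k`-th derivative maps `W_p^{q+k}` to `W_p^q`. -/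
theorem IsSobolev.iteratedDeriv (k : ℕ) (h : IsSobolev a b p (q + k) f) (hab : a < b) :
    IsSobolev a b p q (iteratedDerivWithin k f (Icc a b)) := by
  induction k generalizing f with
  | zero => simpa using h
  | succ k ih =>
    have e : iteratedDerivWithin (k + 1) f (Icc a b)
        = iteratedDerivWithin k (derivWithin f (Icc a b)) (Icc a b) := by
      funext x; rw [iteratedDerivWithin_succ']
    rw [e]
    apply ih
    rw [← add_assoc] at h
    rcases hqk : q + k with _ | j
    · rw [hqk] at h; exact (isSobolev_one.1 h).2.2
    · rw [hqk] at h; exact ((isSobolev_succ_succ hab).1 h).2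

theorem IsSobolev.of_succ (hab : a < b) (h : IsSobolev a b p (q + 1) f) :
    IsSobolev a b p q f := by
  induction q generalizing f with
  | zero => exact memLp_of_continuousOn h.continuousOn
  | succ q ih =>
    have h' := (isSobolev_succ_succ hab).1 h
    cases q with
    | zero =>
      exact isSobolev_one.2 ⟨h.continuousOn, h.ac hab, ih h'.2⟩
    | succ q => exact (isSobolev_succ_succ hab).2 ⟨h'.1, ih h'.2⟩

theorem IsSobolev.mono (hab : a < b) {q' : ℕ} (hq : q ≤ q') (h : IsSobolev a b p q' f) :
    IsSobolev a b p q f := by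
  induction hq with
  | refl => exact h
  | step _ ih => exact ih (h.of_succ hab)

theorem memLp_mul_continuousOn (hf : MemLp f p (intervalMeasure a b))
    (hg : ContinuousOn g (Icc a b)) : MemLp (fun x => f x * g x) p (intervalMeasure a b) := by
  have h : MemLp g ∞ (intervalMeasure a b) := memLp_of_continuousOn hg
  exact h.mul' hf

/-- A product of a function of `W_p^q` and a function of `W_p^{q+1}` is in `W_p^q`. -/
theorem IsSobolev.mul (hab : a < b) (hf : IsSobolev a b p q f) (hg : IsSobolev a b p (q + 1) g) :
    IsSobolev a b p q (fun x => f x * g x) := by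
  induction q generalizing f g with
  | zero => exact memLp_mul_continuousOn hf hg.continuousOn
  | succ q ih =>
    have hg0 := hg.of_succ hab
    have hgd := (isSobolev_succ_succ hab).1 hg
    cases q with
    | zero =>
      have hf' := isSobolev_one.1 hf
      refine isSobolev_one.2 ⟨hf'.1.mul hg.continuousOn, hf'.2.1.smul (hg.ac hab), ?_⟩
      have h1 : MemLp (fun x => derivWithin f (Icc a b) x * g x) p (intervalMeasure a b) :=
        memLp_mul_continuousOn hf'.2.2 hg.continuousOn
      have h2 : MemLp (fun x => f x * derivWithin g (Icc a b) x) p (intervalMeasure a b) :=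
        memLp_of_continuousOn (hf'.1.mul hgd.2.continuousOn)
      refine MemLp.ae_eq ?_ (h1.add h2)
      filter_upwards [ac_ae_diff hab hf'.2.1] with x hx
      exact (derivWithin_fun_mul hx.2 (hgd.1 x hx.1)).symm
    | succ q =>
      have hfd := (isSobolev_succ_succ hab).1 hf
      refine (isSobolev_succ_succ hab).2 ⟨hfd.1.mul hgd.1, ?_⟩
      have h1 := ih hfd.2 hg0
      have h2 := ih (hgd.2.of_succ hab) hf
      refine (h1.add hab h2).congr hab fun x hx => ?_
      rw [derivWithin_fun_mul (hfd.1 x hx) (hgd.1 x hx)]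
      ring

theorem iteratedDeriv_add_ae (hab : a < b) (hf : IsSobolev a b p q f) (hg : IsSobolev a b p q g)
    {k : ℕ} (hk : k ≤ q) :
    (iteratedDerivWithin k (fun x => f x + g x) (Icc a b)) =ᵐ[intervalMeasure a b]
      fun x => iteratedDerivWithin k f (Icc a b) x + iteratedDerivWithin k g (Icc a b) x := by
  have hu : UniqueDiffOn ℝ (Icc a b) := uniqueDiffOn_Icc hab
  induction q generalizing f g k with
  | zero =>
    obtain rfl : k = 0 := by omega
    simp
  | succ q ih =>
    cases k with
    | zero => simp
    | succ k =>
      cases q with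
      | zero =>
        obtain rfl : k = 0 := by omega
        filter_upwards [ac_ae_diff hab (hf.ac hab), ac_ae_diff hab (hg.ac hab)] with x h1 h2
        simp only [zero_add, iteratedDerivWithin_one]
        exact derivWithin_fun_add h1.2 h2.2
      | succ q =>
        have hf' := (isSobolev_succ_succ hab).1 hf
        have hg' := (isSobolev_succ_succ hab).1 hg
        filter_upwards [ih hf'.2 hg'.2 (show k ≤ q + 1 by omega),
          ae_restrict_mem measurableSet_Icc] with x hx hx'
        simp only [iteratedDerivWithin_succ']
        rw [← hx]
        exact iteratedDerivWithin_congr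
          (fun z hz => derivWithin_fun_add (hf'.1 z hz) (hg'.1 z hz)) hx'

theorem IsSobolev.const_mul (hab : a < b) (c : ℂ) (hf : IsSobolev a b p q f) :
    IsSobolev a b p q (fun x => c * f x) := by
  induction q generalizing f with
  | zero => exact MemLp.const_mul hf c
  | succ q ih =>
    have hd : derivWithin (fun x => c * f x) (Icc a b)
        = fun x => c * derivWithin f (Icc a b) x := by
      funext x; exact derivWithin_const_mul_field c
    cases q with
    | zero =>
      rw [isSobolev_one] at hf ⊢
      refine ⟨continuousOn_const.mul hf.1, hf.2.1.const_smul c, ?_⟩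
      rw [hd]; exact hf.2.2.const_mul c
    | succ q =>
      rw [isSobolev_succ_succ hab] at hf ⊢
      rw [hd]
      exact ⟨hf.1.const_mul c, ih hf.2⟩

theorem iteratedDeriv_const_mul (k : ℕ) (c : ℂ) (f : ℝ → ℂ) (s : Set ℝ) :
    iteratedDerivWithin k (fun x => c * f x) s = fun x => c * iteratedDerivWithin k f s x := by
  induction k generalizing f with
  | zero => simp
  | succ k ih =>
    funext x
    rw [iteratedDerivWithin_succ', iteratedDerivWithin_succ']
    have hd : derivWithin (fun x => c * f x) s = fun x => c * derivWithin f s x := by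
      funext x; exact derivWithin_const_mul_field c
    rw [hd, ih]

theorem IsSobolev.memLp_iteratedDeriv (hab : a < b) (hf : IsSobolev a b p q f) {k : ℕ}
    (hk : k ≤ q) : MemLp (iteratedDerivWithin k f (Icc a b)) p (intervalMeasure a b) := by
  have h : IsSobolev a b p (0 + k) f := hf.mono hab (by omega)
  exact h.iteratedDeriv k hab

theorem IsSobolev.iteratedDeriv_congr_ae (hab : a < b) (hf : IsSobolev a b p q f)
    (hg : IsSobolev a b p q g) (h : f =ᵐ[intervalMeasure a b] g) {k : ℕ} (hk : k ≤ q) :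
    iteratedDerivWithin k f (Icc a b) =ᵐ[intervalMeasure a b]
      iteratedDerivWithin k g (Icc a b) := by
  cases q with
  | zero =>
    obtain rfl : k = 0 := by omega
    simpa using h
  | succ q =>
    have he : EqOn f g (Icc a b) :=
      Measure.eqOn_Icc_of_ae_eq volume hab.ne h hf.continuousOn hg.continuousOn
    exact ae_of_forall_Icc (iteratedDerivWithin_congr he)

end helpers

/-- The complex Sobolev space `W_p^q([a, b]; ℂ)`. A function `y` of this space is recorded by the
tuple `(y, y', …, y^{(q)})` of its derivatives, each being a class in `L_p`; the norm is
`‖y‖ + ‖y'‖ + ⋯ + ‖y^{(q)}‖`, a sum of `L_p` norms. -/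
def sobolevSpace {a b : ℝ} (hab : a < b) (p : ℝ≥0∞) [Fact (1 ≤ p)] (q : ℕ) :
    Submodule ℂ (PiLp 1 fun _ : Fin (q + 1) => Lp ℂ p (intervalMeasure a b)) where
  carrier := {u | ∃ y : ℝ → ℂ, IsSobolev a b p q y ∧
    ∀ k : Fin (q + 1), u k =ᵐ[intervalMeasure a b] iteratedDerivWithin k y (Icc a b)}
  zero_mem' := by
    refine ⟨fun _ => 0, isSobolev_zero_fun hab, fun k => ?_⟩
    have h0 : iteratedDerivWithin k (fun _ : ℝ => (0 : ℂ)) (Icc a b) = fun _ => 0 := by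
      simpa using iteratedDeriv_const_mul k 0 (fun _ => 0) (Icc a b)
    rw [h0]
    exact Lp.coeFn_zero ℂ p _
  add_mem' := by
    rintro u v ⟨y, hy, hu⟩ ⟨z, hz, hv⟩
    refine ⟨fun x => y x + z x, hy.add hab hz, fun k => ?_⟩
    filter_upwards [hu k, hv k, Lp.coeFn_add (u k) (v k),
      iteratedDeriv_add_ae hab hy hz (Nat.le_of_lt_succ k.2)] with x h1 h2 h3 h4
    rw [h4, ← h1, ← h2]
    exact h3
  smul_mem' := by
    rintro c u ⟨y, hy, hu⟩
    refine ⟨fun x => c * y x, hy.const_mul hab c, fun k => ?_⟩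
    rw [iteratedDeriv_const_mul]
    filter_upwards [hu k, Lp.coeFn_smul c (u k)] with x h1 h2
    rw [← h1]
    exact h2

variable {a b : ℝ} {hab : a < b} {p : ℝ≥0∞} [Fact (1 ≤ p)] {q : ℕ}

/-- An element of `W_p^q` is determined by the class of the function itself. -/
theorem sobolevSpace_ext {u v : sobolevSpace hab p q} (h : u.1 0 = v.1 0) : u = v := by
  obtain ⟨u, y, hy, hu⟩ := u
  obtain ⟨v, z, hz, hv⟩ := v
  have h0 : y =ᵐ[intervalMeasure a b] z := by
    have h1 := hu 0
    have h2 := hv 0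
    simp only [Fin.val_zero, iteratedDerivWithin_zero] at h1 h2
    have h3 : u 0 = v 0 := h
    rw [h3] at h1
    exact h1.symm.trans h2
  refine Subtype.ext (PiLp.ext fun k => Lp.ext ?_)
  exact (hu k).trans ((hy.iteratedDeriv_congr_ae hab hz h0 (Nat.le_of_lt_succ k.2)).trans
    (hv k).symm)

/-- The element of the space `W_p^q` given by a function. -/
def ofFun (hab : a < b) (y : ℝ → ℂ) (hy : IsSobolev a b p q y) : sobolevSpace hab p q :=
  ⟨WithLp.toLp 1 fun k => (hy.memLp_iteratedDeriv hab (Nat.le_of_lt_succ k.2)).toLp _,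
    y, hy, fun k => MemLp.coeFn_toLp (hy.memLp_iteratedDeriv hab (Nat.le_of_lt_succ k.2))⟩

/-- A function that represents an element of `W_p^q`. -/
def rep (u : sobolevSpace hab p q) : ℝ → ℂ := u.2.choose

theorem rep_isSobolev (u : sobolevSpace hab p q) : IsSobolev a b p q (rep u) :=
  u.2.choose_spec.1

theorem rep_ae (u : sobolevSpace hab p q) : u.1 0 =ᵐ[intervalMeasure a b] rep u := by
  have h := u.2.choose_spec.2 0
  rw [Fin.val_zero, iteratedDerivWithin_zero] at h
  exact h

theorem ofFun_ae (y : ℝ → ℂ) (hy : IsSobolev a b p q y) :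
    (ofFun hab y hy).1 0 =ᵐ[intervalMeasure a b] y := by
  have h : (ofFun hab y hy).1 0 =ᵐ[intervalMeasure a b] iteratedDerivWithin 0 y (Icc a b) :=
    MemLp.coeFn_toLp (hy.memLp_iteratedDeriv hab (Nat.zero_le q))
  rwa [iteratedDerivWithin_zero] at h

/-- The derivative `y ↦ y^{(j)}` as an operator from `W_p^{q'}` to `W_p^q`, where `q + j ≤ q'`. -/
def iterDeriv {q q' : ℕ} (j : ℕ) (h : q + j ≤ q') :
    sobolevSpace hab p q' →ₗ[ℂ] sobolevSpace hab p q where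
  toFun u := ⟨WithLp.toLp 1 fun k => u.1 ⟨k + j, by omega⟩, by
    obtain ⟨y, hy, hu⟩ := u.2
    refine ⟨iteratedDerivWithin j y (Icc a b), (hy.mono hab h).iteratedDeriv j hab, fun k => ?_⟩
    have e : iteratedDerivWithin k (iteratedDerivWithin j y (Icc a b)) (Icc a b)
        = iteratedDerivWithin (k + j) y (Icc a b) := by
      have e' : ∀ (i : ℕ) (g : ℝ → ℂ), iteratedDerivWithin i g (Icc a b)
          = (fun g : ℝ → ℂ => derivWithin g (Icc a b))^[i] g :=
        fun i g => funext fun x => iteratedDerivWithin_eq_iterate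
      rw [e', e', e', Function.iterate_add_apply]
    rw [e]
    exact hu ⟨k + j, by omega⟩⟩
  map_add' _ _ := rfl
  map_smul' _ _ := rfl

/-- Multiplication `u ↦ A u` by a function `A ∈ W_p^q`, as an operator from `W_p^{q+1}` to
`W_p^q`. -/
def mulOp (A : sobolevSpace hab p q) :
    sobolevSpace hab p (q + 1) →ₗ[ℂ] sobolevSpace hab p q where
  toFun u := ofFun hab (fun x => rep A x * rep u x)
    (IsSobolev.mul hab (rep_isSobolev A) (rep_isSobolev u))
  map_add' u v := by
    refine sobolevSpace_ext (Lp.ext ?_)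
    refine (ofFun_ae _ _).trans ?_
    refine EventuallyEq.trans ?_ (Lp.coeFn_add _ _).symm
    filter_upwards [rep_ae u, rep_ae v, rep_ae (u + v), Lp.coeFn_add (u.1 0) (v.1 0),
      ofFun_ae (hab := hab) _ (IsSobolev.mul hab (rep_isSobolev A) (rep_isSobolev u)),
      ofFun_ae (hab := hab) _ (IsSobolev.mul hab (rep_isSobolev A) (rep_isSobolev v))]
      with x h1 h2 h3 h4 h5 h6
    have h7 : ((u + v).1 0 : ℝ → ℂ) x = u.1 0 x + v.1 0 x := h4
    refine Eq.trans ?_ (congrArg₂ (· + ·) h5 h6).symm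
    rw [← h3, h7, h1, h2]
    ring
  map_smul' c u := by
    refine sobolevSpace_ext (Lp.ext ?_)
    refine (ofFun_ae _ _).trans ?_
    refine EventuallyEq.trans ?_ (Lp.coeFn_smul _ _).symm
    filter_upwards [rep_ae u, rep_ae (c • u), Lp.coeFn_smul c (u.1 0),
      ofFun_ae (hab := hab) _ (IsSobolev.mul hab (rep_isSobolev A) (rep_isSobolev u))]
      with x h1 h3 h4 h5
    have h7 : ((c • u).1 0 : ℝ → ℂ) x = c * u.1 0 x := h4
    refine Eq.trans ?_ (congrArg (c * ·) h5).symm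
    rw [← h3, h7, h1]
    ring

/-- The differential operator
`(L y)(t) = y^{(r)}(t) + ∑_{j < r} A_j(t) y^{(j)}(t)` from `(W_p^{n+r})^m` to `(W_p^n)^m`, where
`A_0, …, A_{r-1}` are `m × m` matrix-valued functions with entries in `W_p^n`. -/
def diffOp {n m r : ℕ} (A : Fin r → Matrix (Fin m) (Fin m) (sobolevSpace hab p n)) :
    (Fin m → sobolevSpace hab p (n + r)) →ₗ[ℂ] (Fin m → sobolevSpace hab p n) :=
  LinearMap.pi fun i =>
    (iterDeriv r le_rfl : sobolevSpace hab p (n + r) →ₗ[ℂ] sobolevSpace hab p n) ∘ₗ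
      LinearMap.proj i +
    ∑ j : Fin r, ∑ s : Fin m, mulOp (A j i s) ∘ₗ
      (iterDeriv (j : ℕ) (by omega) :
        sobolevSpace hab p (n + r) →ₗ[ℂ] sobolevSpace hab p (n + 1)) ∘ₗ LinearMap.proj s

/-- The operator `(L, B)` of the boundary-value problem `L y = f`, `B y = c`. -/
def bvpOp {n m r l : ℕ} (A : Fin r → Matrix (Fin m) (Fin m) (sobolevSpace hab p n))
    (B : (Fin m → sobolevSpace hab p (n + r)) →L[ℂ] (Fin l → ℂ)) :
    (Fin m → sobolevSpace hab p (n + r)) →ₗ[ℂ]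
      (Fin m → sobolevSpace hab p n) × (Fin l → ℂ) :=
  (diffOp A).prod (B : (Fin m → sobolevSpace hab p (n + r)) →ₗ[ℂ] (Fin l → ℂ))

/-- Dimension of the kernel of a linear operator. -/
def dimKer {X Y : Type} [AddCommGroup X] [Module ℂ X] [AddCommGroup Y] [Module ℂ Y]
    (T : X →ₗ[ℂ] Y) : Cardinal := Module.rank ℂ (LinearMap.ker T)

/-- Dimension of the cokernel `Y / T(X)` of a linear operator. -/
def dimCoker {X Y : Type} [AddCommGroup X] [Module ℂ X] [AddCommGroup Y] [Module ℂ Y]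
    (T : X →ₗ[ℂ] Y) : Cardinal := Module.rank ℂ (Y ⧸ LinearMap.range T)

/-- Invertibility: the operator is bijective, and it and its inverse are continuous. -/
def IsInvertibleOp {X Y : Type} [AddCommGroup X] [Module ℂ X] [TopologicalSpace X]
    [AddCommGroup Y] [Module ℂ Y] [TopologicalSpace Y] (T : X →ₗ[ℂ] Y) : Prop :=
  ∃ e : X ≃L[ℂ] Y, ∀ x, e x = T x

end SobolevBVP

end

/-! The problem reduces to maps into the finite-dimensional space `ℂ^l`. The operator `L` is onto
and has a continuous right inverse `R`: composed with `r`-fold integration from `a`, it becomes the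
identity plus a Volterra operator, whose iterates decay like `Γ^k / k!`
(`exists_rightInverse_diffOpL`). Hence the kernel and cokernel of `(L, B)` have the same dimensions
as those of `B` restricted to `ker L` (`dimKer_prod`, `dimCoker_prod`).

Strong convergence of `L(k)` is in fact norm convergence. Testing on the monomials `(x - a)^j / j!`
gives a triangular system for the coefficients, so these converge in `W_p^n` (`tendsto_coeff`), and
the operator depends continuously in norm on its coefficients (`continuous_diffOpL`).

Thus `L(k) R` is invertible for large `k`, and `R (L(k) R)⁻¹` is a right inverse of `L(k)` with the
range of `R`. Projecting along this common range identifies `ker L` with `ker L(k)`, and `B(k)` on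
`ker L(k)` becomes a map on the fixed space `ker L`. By Banach–Steinhaus these maps converge
pointwise to `B` on `ker L`. Rank is lower semicontinuous under pointwise convergence, so by
rank-nullity the dimensions of kernel and cokernel can only drop (`eventually_dim_le`). The
remaining claims are the cases of dimension zero, with the open mapping theorem for continuity of
the inverse. -/

noncomputable section

namespace SobolevBVP

/-! ### Primitives and products in Sobolev spaces -/

section Primitive

variable {a b : ℝ} {p : ℝ≥0∞} {q : ℕ} {f g : ℝ → ℂ}

theorem integrable_of_memLp (hp : 1 ≤ p) (hf : MemLp f p (intervalMeasure a b)) :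
    IntegrableOn f (Icc a b) :=
  hf.integrable hp

theorem intervalIntegrable_of_integrableOn {E : Type*} [NormedAddCommGroup E] {f : ℝ → E}
    (hf : IntegrableOn f (Icc a b)) {x y : ℝ} (hx : x ∈ Icc a b) (hy : y ∈ Icc a b) :
    IntervalIntegrable f volume x y := by
  rw [intervalIntegrable_iff]
  exact hf.mono_set (uIoc_subset_uIcc.trans (uIcc_subset_Icc hx hy))

/-- Each increment of the primitive is bounded by the same increment of the real primitive of `‖f‖`,
so the `δ` of the latter serves. -/
theorem ac_primitive (hab : a < b) (hf : IntegrableOn f (Icc a b)) :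
    AbsolutelyContinuousOnInterval (fun x => ∫ t in a..x, f t) a b := by
  have ha : a ∈ Icc a b := left_mem_Icc.2 hab.le
  have hb : b ∈ Icc a b := right_mem_Icc.2 hab.le
  have hn : IntegrableOn (fun t => ‖f t‖) (Icc a b) := hf.norm
  have h := (intervalIntegrable_of_integrableOn hn ha hb
    ).absolutelyContinuousOnInterval_intervalIntegral (c := a) left_mem_uIcc
  rw [absolutelyContinuousOnInterval_iff] at h ⊢
  intro ε hε
  obtain ⟨δ, hδ, H⟩ := h ε hε
  refine ⟨δ, hδ, fun E hE hs => (Finset.sum_le_sum fun i hi => ?_).trans_lt (H E hE hs)⟩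
  have h1 := hE.1 i hi
  rw [uIcc_of_le hab.le] at h1
  rw [dist_eq_norm, dist_eq_norm, Real.norm_eq_abs,
    intervalIntegral.integral_interval_sub_left (intervalIntegrable_of_integrableOn hf ha h1.1)
      (intervalIntegrable_of_integrableOn hf ha h1.2),
    intervalIntegral.integral_interval_sub_left (intervalIntegrable_of_integrableOn hn ha h1.1)
      (intervalIntegrable_of_integrableOn hn ha h1.2)]
  exact intervalIntegral.norm_integral_le_abs_integral_norm

theorem derivWithin_primitive_ae (hab : a < b) (hf : IntegrableOn f (Icc a b)) :
    derivWithin (fun x => ∫ t in a..x, f t) (Icc a b) =ᵐ[intervalMeasure a b] f := by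
  have h := (intervalIntegrable_of_integrableOn hf (left_mem_Icc.2 hab.le)
    (right_mem_Icc.2 hab.le)).ae_hasDerivAt_integral
  rw [uIcc_of_le hab.le] at h
  filter_upwards [ae_restrict_of_ae h, ae_restrict_mem measurableSet_Icc] with x hx hx'
  exact (hx hx' a (left_mem_Icc.2 hab.le)).hasDerivWithinAt.derivWithin
    (uniqueDiffOn_Icc hab x hx')

theorem hasDerivWithinAt_primitive (hab : a < b) (hf : ContinuousOn f (Icc a b)) {x : ℝ}
    (hx : x ∈ Icc a b) :
    HasDerivWithinAt (fun x => ∫ t in a..x, f t) (f x) (Icc a b) x := by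
  have : Fact (x ∈ Icc a b) := ⟨hx⟩
  exact intervalIntegral.integral_hasDerivWithinAt_right
    (intervalIntegrable_of_integrableOn hf.integrableOn_Icc (left_mem_Icc.2 hab.le) hx)
    (hf.stronglyMeasurableAtFilter_nhdsWithin measurableSet_Icc x) (hf x hx)

/-- The primitive of a function of `W_p^q` is in `W_p^{q+1}`. -/
theorem IsSobolev.const_add_primitive (hp : 1 ≤ p) (hab : a < b) (c : ℂ)
    (hf : IsSobolev a b p q f) : IsSobolev a b p (q + 1) (fun x => c + ∫ t in a..x, f t) := by
  have hfi : IntegrableOn f (Icc a b) :=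
    integrable_of_memLp hp (hf.mono (q := 0) hab (Nat.zero_le q))
  cases q with
  | zero =>
    have h1 : AbsolutelyContinuousOnInterval (fun _ : ℝ => c) a b := by
      have h1 : ContDiffOn ℝ 1 (fun _ : ℝ => c) (uIcc a b) := contDiffOn_const
      exact h1.absolutelyContinuousOnInterval
    have hac : AbsolutelyContinuousOnInterval (fun x => c + ∫ t in a..x, f t) a b :=
      h1.add (ac_primitive hab hfi)
    refine isSobolev_one.2 ⟨?_, hac, ?_⟩
    · simpa [uIcc_of_le hab.le] using hac.continuousOn
    · refine MemLp.ae_eq ?_ hf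
      filter_upwards [derivWithin_primitive_ae hab hfi] with x hx
      rw [derivWithin_const_add, hx]
  | succ q =>
    have hd : ∀ x ∈ Icc a b, HasDerivWithinAt (fun x => c + ∫ t in a..x, f t) (f x) (Icc a b) x :=
      fun x hx => (hasDerivWithinAt_primitive hab hf.continuousOn hx).const_add c
    refine (isSobolev_succ_succ hab).2 ⟨fun x hx => (hd x hx).differentiableWithinAt,
      hf.congr hab fun x hx => ?_⟩
    exact ((hd x hx).derivWithin (uniqueDiffOn_Icc hab x hx)).symm

/-- The fundamental theorem of calculus in `W_p^{q+1}`. -/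
theorem IsSobolev.eq_const_add_primitive (hp : 1 ≤ p) (hab : a < b)
    (hf : IsSobolev a b p (q + 1) f) :
    ∃ c, ∀ x ∈ Icc a b, f x = c + ∫ t in a..x, derivWithin f (Icc a b) t := by
  have hd : MemLp (derivWithin f (Icc a b)) p (intervalMeasure a b) := by
    simpa using hf.memLp_iteratedDeriv hab (k := 1) (by omega)
  have hdi := integrable_of_memLp hp hd
  have hac := (hf.ac hab).sub (ac_primitive hab hdi)
  -- The function minus the primitive of its derivative is absolutely continuous with zero
  -- derivative almost everywhere, hence constant. The endpoints are discarded because the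
  -- derivative within `[a, b]` is two-sided only at interior points.
  obtain ⟨C, hC⟩ := hac.const_of_ae_hasDerivAt_zero (by
    have h1 := (intervalIntegrable_of_integrableOn hdi (left_mem_Icc.2 hab.le)
      (right_mem_Icc.2 hab.le)).ae_hasDerivAt_integral
    have h2 := (ae_restrict_iff' measurableSet_Icc).1 (ac_ae_diff hab (hf.ac hab))
    have h3 : ∀ᵐ x : ℝ, x ≠ a := by simp [ae_iff, measure_singleton]
    have h4 : ∀ᵐ x : ℝ, x ≠ b := by simp [ae_iff, measure_singleton]
    rw [uIcc_of_le hab.le] at h1 ⊢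
    filter_upwards [h1, h2, h3, h4] with x h1 h2 h3 h4 hx
    have hn : Icc a b ∈ 𝓝 x := Icc_mem_nhds (lt_of_le_of_ne hx.1 h3.symm) (lt_of_le_of_ne hx.2 h4)
    have h5 := ((h2 hx).2.hasDerivWithinAt.hasDerivAt hn).sub (h1 hx a (left_mem_Icc.2 hab.le))
    rwa [sub_self] at h5)
  refine ⟨C, fun x hx => ?_⟩
  rw [← hC x (by rwa [uIcc_of_le hab.le])]
  simp

/-- `W_p^{q+1}` is an algebra. -/
theorem IsSobolev.mul_same (hab : a < b) (hf : IsSobolev a b p (q + 1) f)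
    (hg : IsSobolev a b p (q + 1) g) : IsSobolev a b p (q + 1) (fun x => f x * g x) := by
  cases q with
  | zero =>
    have hf' := isSobolev_one.1 hf
    have hg' := isSobolev_one.1 hg
    refine isSobolev_one.2 ⟨hf'.1.mul hg'.1, hf'.2.1.smul hg'.2.1, ?_⟩
    have h1 := memLp_mul_continuousOn hf'.2.2 hg'.1
    have h2 := memLp_mul_continuousOn hg'.2.2 hf'.1
    refine MemLp.ae_eq ?_ (h1.add h2)
    filter_upwards [ac_ae_diff hab hf'.2.1, ac_ae_diff hab hg'.2.1] with x hx hy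
    rw [derivWithin_fun_mul hx.2 hy.2]
    simp only [Pi.add_apply]
    ring
  | succ q =>
    have hf' := (isSobolev_succ_succ hab).1 hf
    have hg' := (isSobolev_succ_succ hab).1 hg
    refine (isSobolev_succ_succ hab).2 ⟨hf'.1.mul hg'.1, ?_⟩
    refine ((hf'.2.mul hab hg).add hab (hg'.2.mul hab hf)).congr hab fun x hx => ?_
    rw [derivWithin_fun_mul (hf'.1 x hx) (hg'.1 x hx)]
    ring

theorem norm_primitive_le (hab : a < b) (hf : IntegrableOn f (Icc a b)) {x : ℝ}
    (hx : x ∈ Icc a b) : ‖∫ t in a..x, f t‖ ≤ ∫ t in a..b, ‖f t‖ := by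
  refine (intervalIntegral.norm_integral_le_integral_norm hx.1).trans ?_
  exact intervalIntegral.integral_mono_interval le_rfl hx.1 hx.2
    (Eventually.of_forall fun _ => norm_nonneg _)
    (intervalIntegrable_of_integrableOn hf.norm (left_mem_Icc.2 hab.le) (right_mem_Icc.2 hab.le))

end Primitive

/-! ### Constants in `L_p` -/

section Constant

variable {a b : ℝ} {p : ℝ≥0∞}

/-- The constant function `1` in `L_p`. -/
def oneLp (a b : ℝ) (p : ℝ≥0∞) : Lp ℂ p (intervalMeasure a b) :=
  (memLp_of_continuousOn (f := fun _ => (1 : ℂ)) continuousOn_const).toLp _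

theorem smul_oneLp_ae (c : ℂ) : (c • oneLp a b p : Lp ℂ p (intervalMeasure a b))
    =ᵐ[intervalMeasure a b] fun _ => c := by
  filter_upwards [Lp.coeFn_smul c (oneLp a b p), MemLp.coeFn_toLp (memLp_of_continuousOn (p := p)
    (f := fun _ => (1 : ℂ)) (a := a) (b := b) continuousOn_const)] with x h1 h2
  rw [h1, Pi.smul_apply, oneLp, h2]
  simp

end Constant

/-! ### The Volterra operator on `L_p` -/

section Volterra

variable {a b : ℝ} {p : ℝ≥0∞} [Fact (1 ≤ p)] {q : ℕ}

theorem Lp_integrableOn (f : Lp ℂ p (intervalMeasure a b)) : IntegrableOn f (Icc a b) :=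
  integrable_of_memLp Fact.out (Lp.memLp f)

/-- Hölder's inequality on a set of finite measure: the constant is the measure to the power `1 -
1/p`. -/
theorem exists_integral_norm_le (hab : a < b) (p : ℝ≥0∞) [Fact (1 ≤ p)] :
    ∃ C : ℝ, 0 ≤ C ∧ ∀ f : Lp ℂ p (intervalMeasure a b), ∫ t in a..b, ‖f t‖ ≤ C * ‖f‖ := by
  refine ⟨(intervalMeasure a b univ ^ (1 / (1 : ℝ≥0∞).toReal - 1 / p.toReal)).toReal,
    ENNReal.toReal_nonneg, fun f => ?_⟩
  have hp : 1 ≤ p := Fact.out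
  have hex : 0 ≤ 1 / (1 : ℝ≥0∞).toReal - 1 / p.toReal := by
    rcases eq_or_ne p ∞ with rfl | hp'
    -- Here `p.toReal = 0` and `1 / 0 = 0`, so the exponent is `1`, the correct value for `p = ∞`.
    · simp
    · have : 1 ≤ p.toReal := by
        rw [← ENNReal.toReal_one]
        exact (ENNReal.toReal_le_toReal ENNReal.one_ne_top hp').2 hp
      simp only [ENNReal.toReal_one, div_one, sub_nonneg]
      exact (div_le_one (by linarith)).2 this
  have h := eLpNorm_le_eLpNorm_mul_rpow_measure_univ (p := 1) (q := p) hp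
    (Lp.aestronglyMeasurable f)
  have hfin : eLpNorm f p (intervalMeasure a b) *
      intervalMeasure a b univ ^ (1 / (1 : ℝ≥0∞).toReal - 1 / p.toReal) ≠ ∞ :=
    ENNReal.mul_ne_top (Lp.eLpNorm_ne_top f)
      (ENNReal.rpow_ne_top_of_nonneg hex (measure_ne_top _ _))
  have h2 := ENNReal.toReal_mono hfin h
  rw [ENNReal.toReal_mul, eLpNorm_one_eq_lintegral_enorm,
    ← integral_norm_eq_lintegral_enorm (Lp.aestronglyMeasurable f)] at h2
  rw [intervalIntegral.integral_of_le hab.le, ← integral_Icc_eq_integral_Ioc, mul_comm, Lp.norm_def]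
  exact h2

theorem continuousOn_primitive (hab : a < b) {f : ℝ → ℂ} (hf : IntegrableOn f (Icc a b)) :
    ContinuousOn (fun x => ∫ t in a..x, f t) (Icc a b) := by
  simpa [uIcc_of_le hab.le] using (ac_primitive hab hf).continuousOn

theorem primitive_congr {f g : ℝ → ℂ} (h : f =ᵐ[intervalMeasure a b] g) {x : ℝ}
    (hx : x ∈ Icc a b) : ∫ t in a..x, f t = ∫ t in a..x, g t := by
  refine intervalIntegral.integral_congr_ae ?_
  filter_upwards [(ae_restrict_iff' measurableSet_Icc).1 h] with t ht ht'
  rw [uIoc_of_le hx.1] at ht'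
  exact ht ⟨ht'.1.le, ht'.2.trans hx.2⟩

/-- The Volterra operator `f ↦ ∫_a^x f` on `L_p`, as a linear map. -/
def volterraLinear (hab : a < b) (p : ℝ≥0∞) [Fact (1 ≤ p)] :
    Lp ℂ p (intervalMeasure a b) →ₗ[ℂ] Lp ℂ p (intervalMeasure a b) where
  toFun f := (memLp_of_continuousOn (p := p)
    (continuousOn_primitive hab (Lp_integrableOn f))).toLp _
  map_add' f g := by
    refine Lp.ext ?_
    filter_upwards [MemLp.coeFn_toLp (memLp_of_continuousOn (p := p)
        (continuousOn_primitive hab (Lp_integrableOn (f + g)))), Lp.coeFn_add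
        ((memLp_of_continuousOn (p := p) (continuousOn_primitive hab (Lp_integrableOn f))).toLp _)
        ((memLp_of_continuousOn (p := p) (continuousOn_primitive hab (Lp_integrableOn g))).toLp _),
      MemLp.coeFn_toLp (memLp_of_continuousOn (p := p)
        (continuousOn_primitive hab (Lp_integrableOn f))),
      MemLp.coeFn_toLp (memLp_of_continuousOn (p := p)
        (continuousOn_primitive hab (Lp_integrableOn g))),
      ae_restrict_mem measurableSet_Icc] with x h1 h2 h3 h4 hx
    rw [h1, h2, Pi.add_apply, h3, h4, primitive_congr (Lp.coeFn_add f g) hx]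
    exact intervalIntegral.integral_add
      (intervalIntegrable_of_integrableOn (Lp_integrableOn f) (left_mem_Icc.2 hab.le) hx)
      (intervalIntegrable_of_integrableOn (Lp_integrableOn g) (left_mem_Icc.2 hab.le) hx)
  map_smul' c f := by
    refine Lp.ext ?_
    filter_upwards [MemLp.coeFn_toLp (memLp_of_continuousOn (p := p)
        (continuousOn_primitive hab (Lp_integrableOn (c • f)))), Lp.coeFn_smul c
        ((memLp_of_continuousOn (p := p) (continuousOn_primitive hab (Lp_integrableOn f))).toLp _),
      MemLp.coeFn_toLp (memLp_of_continuousOn (p := p)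
        (continuousOn_primitive hab (Lp_integrableOn f))),
      ae_restrict_mem measurableSet_Icc] with x h1 h2 h3 hx
    rw [h1, RingHom.id_apply, h2, Pi.smul_apply, h3, primitive_congr (Lp.coeFn_smul c f) hx]
    exact intervalIntegral.integral_smul c _

theorem volterraLinear_ae (hab : a < b) (f : Lp ℂ p (intervalMeasure a b)) :
    volterraLinear hab p f =ᵐ[intervalMeasure a b] fun x => ∫ t in a..x, f t :=
  MemLp.coeFn_toLp (memLp_of_continuousOn (continuousOn_primitive hab (Lp_integrableOn f)))

/-- The Volterra operator `f ↦ ∫_a^x f` on `L_p`. -/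
def volterra (hab : a < b) (p : ℝ≥0∞) [Fact (1 ≤ p)] :
    Lp ℂ p (intervalMeasure a b) →L[ℂ] Lp ℂ p (intervalMeasure a b) :=
  (volterraLinear hab p).mkContinuousOfExistsBound (by
    obtain ⟨C, hC, h⟩ := exists_integral_norm_le hab p
    -- The primitive is bounded by `C * ‖f‖` pointwise; the power of the measure turns this uniform
    -- bound into an `L_p` bound.
    refine ⟨(intervalMeasure a b).real univ ^ p.toReal⁻¹ * C, fun f => ?_⟩
    rw [mul_assoc]
    refine Lp.norm_le_of_ae_bound (by positivity) ?_
    filter_upwards [volterraLinear_ae hab f, ae_restrict_mem measurableSet_Icc] with x h1 hx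
    rw [h1]
    exact (norm_primitive_le hab (Lp_integrableOn f) hx).trans (h f))

theorem volterra_ae (hab : a < b) (f : Lp ℂ p (intervalMeasure a b)) :
    volterra hab p f =ᵐ[intervalMeasure a b] fun x => ∫ t in a..x, f t :=
  volterraLinear_ae hab f

theorem const_add_volterra_ae (hab : a < b) (c : ℂ) (f : Lp ℂ p (intervalMeasure a b)) :
    (c • oneLp a b p + volterra hab p f : Lp ℂ p (intervalMeasure a b))
      =ᵐ[intervalMeasure a b] fun x => c + ∫ t in a..x, f t := by
  filter_upwards [Lp.coeFn_add (c • oneLp a b p) (volterra hab p f), volterra_ae hab f,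
    smul_oneLp_ae (a := a) (b := b) (p := p) c] with x h1 h2 h3
  rw [h1, Pi.add_apply, h2, h3]

end Volterra

/-! ### Completeness of `W_p^q` and integration as an operator -/

section Completeness

variable {a b : ℝ} {hab : a < b} {p : ℝ≥0∞} [Fact (1 ≤ p)] {q : ℕ}

/-- The tuple of derivatives without its first entry. -/
def tailTuple {E : Type*} {q : ℕ} (u : PiLp 1 fun _ : Fin (q + 2) => E) :
    PiLp 1 fun _ : Fin (q + 1) => E :=
  WithLp.toLp 1 fun k => u k.succ

/-- A tuple belongs to `W_p^{q+1}` if and only if its tail belongs to `W_p^q` and its first entry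
is a primitive of its second one. -/
theorem mem_sobolevSpace_succ (u : PiLp 1 fun _ : Fin (q + 2) => Lp ℂ p (intervalMeasure a b)) :
    u ∈ sobolevSpace hab p (q + 1) ↔
      tailTuple u ∈ sobolevSpace hab p q ∧ ∃ c : ℂ, u 0 = c • oneLp a b p + volterra hab p (u 1) := by
  have hp : 1 ≤ p := Fact.out
  constructor
  · intro hu
    refine ⟨(iterDeriv (hab := hab) (p := p) (q := q) 1 le_rfl ⟨u, hu⟩).2, ?_⟩
    obtain ⟨y, hy, h⟩ := hu
    obtain ⟨c, hc⟩ := hy.eq_const_add_primitive hp hab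
    refine ⟨c, Lp.ext ?_⟩
    have h0 := h 0
    have h1 := h 1
    simp only [Fin.val_zero, iteratedDerivWithin_zero, Fin.val_one, iteratedDerivWithin_one]
      at h0 h1
    filter_upwards [h0, const_add_volterra_ae hab c (u 1), ae_restrict_mem measurableSet_Icc]
      with x h2 h3 hx
    rw [h2, h3, hc x hx, primitive_congr h1 hx]
  · rintro ⟨⟨z, hz, h⟩, c, hc⟩
    have hJ := hz.const_add_primitive hp hab c
    have hzi : IntegrableOn z (Icc a b) :=
      integrable_of_memLp hp (hz.mono (q := 0) hab (Nat.zero_le q))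
    have h1 : u 1 =ᵐ[intervalMeasure a b] z := by simpa [tailTuple] using h 0
    refine ⟨_, hJ, fun k => ?_⟩
    refine Fin.cases ?_ (fun k => ?_) k
    · rw [hc]
      simp only [Fin.val_zero, iteratedDerivWithin_zero]
      filter_upwards [const_add_volterra_ae hab c (u 1), ae_restrict_mem measurableSet_Icc]
        with x h3 hx
      rw [h3, primitive_congr h1 hx]
    · refine (h k).trans ?_
      have e : iteratedDerivWithin (k.succ : ℕ) (fun x => c + ∫ t in a..x, z t) (Icc a b)
          = iteratedDerivWithin k
            (derivWithin (fun x => c + ∫ t in a..x, z t) (Icc a b)) (Icc a b) := by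
        funext x
        rw [Fin.val_succ, iteratedDerivWithin_succ']
      rw [e]
      have hJ' := hJ.iteratedDeriv 1 hab
      have e1 : iteratedDerivWithin 1 (fun x => c + ∫ t in a..x, z t) (Icc a b)
        = derivWithin (fun x => c + ∫ t in a..x, z t) (Icc a b) := by
        funext x; simp
      rw [e1] at hJ'
      refine hz.iteratedDeriv_congr_ae hab hJ' ?_ (Nat.le_of_lt_succ k.2)
      filter_upwards [derivWithin_primitive_ae hab hzi] with x hx
      rw [derivWithin_const_add, hx]

/-- By `mem_sobolevSpace_succ`, membership in `W_p^{q+1}` says that the tail lies in `W_p^q` and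
that `u 0` minus the primitive of `u 1` is a constant. Both conditions are closed, the second
because a line is finite-dimensional. The resulting completeness gives access to the closed graph,
open mapping and Banach–Steinhaus theorems. -/
theorem isClosed_sobolevSpace : 
    IsClosed (sobolevSpace hab p q :
      Set (PiLp 1 fun _ : Fin (q + 1) => Lp ℂ p (intervalMeasure a b))) := by
  induction q with
  | zero =>
    convert isClosed_univ
    refine eq_univ_of_forall fun u => ⟨u 0, Lp.memLp (u 0), fun k => ?_⟩
    obtain rfl : k = 0 := by ext; omega
    simp
  | succ q ih =>
    have h : (sobolevSpace hab p (q + 1) :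
          Set (PiLp 1 fun _ : Fin (q + 2) => Lp ℂ p (intervalMeasure a b))) =
        tailTuple ⁻¹' (sobolevSpace hab p q :
          Set (PiLp 1 fun _ : Fin (q + 1) => Lp ℂ p (intervalMeasure a b))) ∩
        (fun u : PiLp 1 (fun _ : Fin (q + 2) => Lp ℂ p (intervalMeasure a b)) =>
          u 0 - volterra hab p (u 1)) ⁻¹'
        (Submodule.span ℂ {oneLp a b p} : Set (Lp ℂ p (intervalMeasure a b))) := by
      ext u
      rw [SetLike.mem_coe, mem_sobolevSpace_succ]
      simp only [mem_inter_iff, mem_preimage, SetLike.mem_coe, Submodule.mem_span_singleton,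
        eq_sub_iff_add_eq, eq_comm]
    rw [h]
    refine (ih.preimage ?_).inter ((Submodule.closed_of_finiteDimensional _).preimage ?_)
    · unfold tailTuple; fun_prop
    · fun_prop

instance : CompleteSpace (sobolevSpace hab p q) :=
  isClosed_sobolevSpace.isComplete.completeSpace_coe

/-- Integration from `a`, as an operator from `W_p^q` to `W_p^{q+1}`. -/
def integOp (hab : a < b) (p : ℝ≥0∞) [Fact (1 ≤ p)] (q : ℕ) :
    sobolevSpace hab p q →L[ℂ] sobolevSpace hab p (q + 1) where
  toFun u := ⟨WithLp.toLp 1 (Fin.cons (volterra hab p (u.1 0)) fun k => u.1 k), by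
    rw [mem_sobolevSpace_succ]
    exact ⟨u.2, 0, by rw [zero_smul, zero_add]; rfl⟩⟩
  map_add' u v := by
    refine sobolevSpace_ext ?_
    exact map_add (volterra hab p) (u.1 0) (v.1 0)
  map_smul' c u := by
    refine sobolevSpace_ext ?_
    exact map_smul (volterra hab p) c (u.1 0)
  cont := by
    refine Continuous.subtype_mk ((PiLp.continuous_toLp 1 _).comp (continuous_pi fun k => ?_)) _
    refine Fin.cases ?_ (fun k => ?_) k
    · simp only [Fin.cons_zero]
      fun_prop
    · simp only [Fin.cons_succ]
      fun_prop

theorem integOp_zero (u : sobolevSpace hab p q) :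
    (integOp hab p q u).1 0 = volterra hab p (u.1 0) := rfl

theorem integOp_succ (u : sobolevSpace hab p q) (k : Fin (q + 1)) :
    (integOp hab p q u).1 k.succ = u.1 k := rfl

end Completeness

/-! ### Continuity of separately continuous bilinear maps -/

section Bilinear

variable {E F G : Type*} [NormedAddCommGroup E] [NormedSpace ℂ E] [CompleteSpace E]
  [NormedAddCommGroup F] [NormedSpace ℂ F] [NormedAddCommGroup G] [NormedSpace ℂ G]
  [CompleteSpace G]

/-- Closed graph theorem: a limit of `f (u k)` in operator norm is identified by evaluating at each
`y`. For multiplication this replaces Leibniz-type norm estimates. -/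
theorem continuous_of_separately_continuous (f : E →ₗ[ℂ] F →L[ℂ] G)
    (h : ∀ y, Continuous fun x => f x y) : Continuous f := by
  refine f.continuous_of_seq_closed_graph fun u x T hu hT => ContinuousLinearMap.ext fun y => ?_
  exact tendsto_nhds_unique
    (((ContinuousLinearMap.apply ℂ G y).continuous.tendsto T).comp hT)
    (((h y).tendsto x).comp hu)

end Bilinear

/-! ### Norm-continuous dependence of a system on its coefficients -/

section System

variable {E F G : Type*} [NormedAddCommGroup E] [NormedSpace ℂ E]
  [NormedAddCommGroup F] [NormedSpace ℂ F] [NormedAddCommGroup G] [NormedSpace ℂ G] {m r : ℕ}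

/-- The operator `y ↦ (D y_i + ∑_{j, s} μ(A_j^{i s}, d_j y_s))_i`. -/
def systemOp (D : E →L[ℂ] G) (d : Fin r → E →L[ℂ] F) (μ : G →L[ℂ] F →L[ℂ] G)
    (A : Fin r → Matrix (Fin m) (Fin m) G) : (Fin m → E) →L[ℂ] (Fin m → G) :=
  ContinuousLinearMap.pi fun i => D ∘L ContinuousLinearMap.proj i +
    ∑ j : Fin r, ∑ s : Fin m, μ (A j i s) ∘L d j ∘L ContinuousLinearMap.proj s

theorem systemOp_apply (D : E →L[ℂ] G) (d : Fin r → E →L[ℂ] F) (μ : G →L[ℂ] F →L[ℂ] G)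
    (A : Fin r → Matrix (Fin m) (Fin m) G) (y : Fin m → E) (i : Fin m) :
    systemOp D d μ A y i = D (y i) + ∑ j : Fin r, ∑ s : Fin m, μ (A j i s) (d j (y s)) := by
  simp [systemOp]

theorem continuous_systemOp (D : E →L[ℂ] G) (d : Fin r → E →L[ℂ] F) (μ : G →L[ℂ] F →L[ℂ] G) :
    Continuous fun A : Fin r → Matrix (Fin m) (Fin m) G => systemOp D d μ A := by
  have h : Continuous fun A : Fin r → Matrix (Fin m) (Fin m) G => fun i : Fin m =>
      D ∘L (ContinuousLinearMap.proj i : (Fin m → E) →L[ℂ] E) +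
    ∑ j : Fin r, ∑ s : Fin m, μ (A j i s) ∘L d j ∘L
      (ContinuousLinearMap.proj s : (Fin m → E) →L[ℂ] E) := by
    refine continuous_pi fun i => continuous_const.add ?_
    refine continuous_finsetSum _ fun j _ => continuous_finsetSum _ fun s _ => ?_
    refine Continuous.clm_comp (μ.continuous.comp ?_) continuous_const
    exact (continuous_apply s).comp ((continuous_apply i).comp (continuous_apply j))
  exact (ContinuousLinearMap.piEquivL ℂ (Fin m → E) fun _ : Fin m => G).continuous.comp h

end System

/-! ### Continuity of differentiation and multiplication -/

section Multiplication

variable {a b : ℝ} {hab : a < b} {p : ℝ≥0∞} [Fact (1 ≤ p)] {q q' : ℕ}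

theorem continuous_coord (k : Fin (q + 1)) : Continuous fun u : sobolevSpace hab p q => u.1 k := by
  fun_prop

theorem continuous_iterDeriv {j : ℕ} (h : q + j ≤ q') :
    Continuous (iterDeriv (hab := hab) (p := p) j h) :=
  Continuous.subtype_mk ((PiLp.continuous_toLp 1 _).comp
    (continuous_pi fun _ => continuous_coord _)) _

/-- An operator that acts as a multiplication operator is continuous. -/
theorem continuous_of_ae_eq_mul (T : sobolevSpace hab p q →ₗ[ℂ] sobolevSpace hab p q')
    (φ : ℝ → ℂ) (h : ∀ u, (T u).1 0 =ᵐ[intervalMeasure a b] fun x => φ x * u.1 0 x) :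
    Continuous T := by
  refine T.continuous_of_seq_closed_graph fun u x y hu hT => sobolevSpace_ext (Lp.ext ?_)
  have h1 := ((continuous_coord (hab := hab) (p := p) (0 : Fin (q + 1))).tendsto x).comp hu
  -- Closed graph: convergence in `L_p` gives convergence almost everywhere along a subsequence. A
  -- further subsequence handles the images, so that both limits can be compared pointwise.
  obtain ⟨ns, hns, h2⟩ := (tendstoInMeasure_of_tendsto_Lp h1).exists_seq_tendsto_ae
  have h3 := (((continuous_coord (hab := hab) (p := p) (0 : Fin (q' + 1))).tendsto y).comp hT).comp
    hns.tendsto_atTop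
  obtain ⟨ms, hms, h4⟩ := (tendstoInMeasure_of_tendsto_Lp h3).exists_seq_tendsto_ae
  filter_upwards [h2, h4, h x, ae_all_iff.2 fun k => h (u k)] with t h2 h4 h5 h6
  rw [h5]
  refine tendsto_nhds_unique h4 ?_
  refine ((h2.comp hms.tendsto_atTop).const_mul (φ t)).congr fun k => ?_
  exact (h6 _).symm

theorem mulOp_ae (A : sobolevSpace hab p q) (u : sobolevSpace hab p (q + 1)) :
    (mulOp A u).1 0 =ᵐ[intervalMeasure a b] fun x => A.1 0 x * u.1 0 x := by
  refine (ofFun_ae _ (IsSobolev.mul hab (rep_isSobolev A) (rep_isSobolev u))).trans ?_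
  filter_upwards [rep_ae A, rep_ae u] with x h1 h2
  rw [h1, h2]

theorem continuous_mulOp (A : sobolevSpace hab p q) : Continuous (mulOp A) :=
  continuous_of_ae_eq_mul _ _ (mulOp_ae A)

theorem mulOp_add (A A' : sobolevSpace hab p q) (u : sobolevSpace hab p (q + 1)) :
    mulOp (A + A') u = mulOp A u + mulOp A' u := by
  refine sobolevSpace_ext (Lp.ext ?_)
  filter_upwards [mulOp_ae (A + A') u, mulOp_ae A u, mulOp_ae A' u,
    Lp.coeFn_add (A.1 0) (A'.1 0), Lp.coeFn_add ((mulOp A u).1 0) ((mulOp A' u).1 0)]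
    with x h1 h2 h3 h4 h5
  have h6 : ((A + A').1 0 : ℝ → ℂ) x = A.1 0 x + A'.1 0 x := h4
  refine Eq.trans ?_ h5.symm
  rw [h1, h6, Pi.add_apply, h2, h3, add_mul]

theorem mulOp_smul (c : ℂ) (A : sobolevSpace hab p q) (u : sobolevSpace hab p (q + 1)) :
    mulOp (c • A) u = c • mulOp A u := by
  refine sobolevSpace_ext (Lp.ext ?_)
  filter_upwards [mulOp_ae (c • A) u, mulOp_ae A u,
    Lp.coeFn_smul c (A.1 0), Lp.coeFn_smul c ((mulOp A u).1 0)]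
    with x h1 h2 h4 h5
  have h6 : ((c • A).1 0 : ℝ → ℂ) x = c * A.1 0 x := h4
  refine Eq.trans ?_ h5.symm
  rw [h1, h6, Pi.smul_apply, h2, smul_eq_mul, mul_assoc]

/-- Multiplication by `A ∈ W_p^q` as a continuous operator. -/
def mulL (A : sobolevSpace hab p q) : sobolevSpace hab p (q + 1) →L[ℂ] sobolevSpace hab p q :=
  ⟨mulOp A, continuous_mulOp A⟩

/-- Multiplication as a bilinear operator. -/
def mulLinear (hab : a < b) (p : ℝ≥0∞) [Fact (1 ≤ p)] (q : ℕ) :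
    sobolevSpace hab p q →ₗ[ℂ] sobolevSpace hab p (q + 1) →L[ℂ] sobolevSpace hab p q where
  toFun A := mulL A
  map_add' A A' := ContinuousLinearMap.ext fun u => mulOp_add A A' u
  map_smul' c A := ContinuousLinearMap.ext fun u => mulOp_smul c A u

/-- Multiplication of a variable `A ∈ W_p^q` by a given function. -/
def mulFlip (u : sobolevSpace hab p (q + 1)) : sobolevSpace hab p q →ₗ[ℂ] sobolevSpace hab p q where
  toFun A := mulOp A u
  map_add' A A' := mulOp_add A A' u
  map_smul' c A := mulOp_smul c A u

theorem continuous_mulFlip (u : sobolevSpace hab p (q + 1)) : Continuous (mulFlip u) :=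
  continuous_of_ae_eq_mul (mulFlip u) (u.1 0) fun A =>
    (mulOp_ae A u).trans (Eventually.of_forall fun _ => mul_comm _ _)

/-- Multiplication as a continuous bilinear operator. -/
def mulBilin (hab : a < b) (p : ℝ≥0∞) [Fact (1 ≤ p)] (q : ℕ) :
    sobolevSpace hab p q →L[ℂ] sobolevSpace hab p (q + 1) →L[ℂ] sobolevSpace hab p q :=
  ⟨mulLinear hab p q, continuous_of_separately_continuous _ continuous_mulFlip⟩

end Multiplication

/-! ### The differential operator as a bounded operator -/

section DiffOp

variable {a b : ℝ} {hab : a < b} {p : ℝ≥0∞} [Fact (1 ≤ p)] {n m r l : ℕ}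

theorem diffOp_apply (A : Fin r → Matrix (Fin m) (Fin m) (sobolevSpace hab p n))
    (y : Fin m → sobolevSpace hab p (n + r)) (i : Fin m) :
    diffOp A y i = iterDeriv r le_rfl (y i) +
      ∑ j : Fin r, ∑ s : Fin m, mulOp (A j i s) (iterDeriv (j : ℕ) (by omega) (y s)) := by
  simp [diffOp]

/-- The derivative of order `j` as a continuous operator. -/
def iterDerivL {q q' : ℕ} (hab : a < b) (p : ℝ≥0∞) [Fact (1 ≤ p)] (j : ℕ) (h : q + j ≤ q') :
    sobolevSpace hab p q' →L[ℂ] sobolevSpace hab p q :=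
  ⟨iterDeriv j h, continuous_iterDeriv h⟩

/-- The differential operator as a continuous operator. -/
def diffOpL (A : Fin r → Matrix (Fin m) (Fin m) (sobolevSpace hab p n)) :
    (Fin m → sobolevSpace hab p (n + r)) →L[ℂ] (Fin m → sobolevSpace hab p n) :=
  systemOp (iterDerivL hab p r le_rfl)
    -- As `j < r`, a derivative of lower order keeps one degree of smoothness more than `W_p^n`,
    -- which multiplication by a coefficient in `W_p^n` requires.
    (fun j : Fin r => iterDerivL hab p (j : ℕ) (show n + 1 + j ≤ n + r by omega))
    (mulBilin hab p n) A

theorem diffOpL_apply (A : Fin r → Matrix (Fin m) (Fin m) (sobolevSpace hab p n))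
    (y : Fin m → sobolevSpace hab p (n + r)) : diffOpL A y = diffOp A y := by
  funext i
  rw [diffOp_apply, diffOpL, systemOp_apply]
  rfl

theorem continuous_diffOpL : Continuous fun A : Fin r → Matrix (Fin m) (Fin m)
    (sobolevSpace hab p n) => diffOpL (r := r) (n := n) A :=
  continuous_systemOp _ _ _

end DiffOp

/-! ### Reduction to the kernel of `L`; rank-nullity -/

section Algebra

variable {N X Y Z : Type} [AddCommGroup N] [Module ℂ N] [AddCommGroup X] [Module ℂ X]
  [AddCommGroup Y] [Module ℂ Y] [AddCommGroup Z] [Module ℂ Z]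

theorem dimKer_prod (L : X →ₗ[ℂ] Y) (B : X →ₗ[ℂ] Z) :
    dimKer (L.prod B) = dimKer (B ∘ₗ (LinearMap.ker L).subtype) := by
  refine LinearEquiv.rank_eq
    { toFun := fun x => ⟨⟨x.1, (Prod.ext_iff.1 x.2).1⟩, (Prod.ext_iff.1 x.2).2⟩
      map_add' := fun _ _ => rfl
      map_smul' := fun _ _ => rfl
      invFun := fun x => ⟨x.1.1, Prod.ext x.1.2 x.2⟩
      left_inv := fun _ => rfl
      right_inv := fun _ => rfl }

/-- Subtracting `R f` from a solution of `L x = f`, `B x = c` leaves an element of `ker L`. So `(f,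
c)` is attained exactly when `c - B (R f)` lies in `B (ker L)`, and this difference induces the
isomorphism of cokernels. -/
theorem dimCoker_prod (L : X →ₗ[ℂ] Y) (B : X →ₗ[ℂ] Z) (R : Y →ₗ[ℂ] X) (hR : ∀ y, L (R y) = y) :
    dimCoker (L.prod B) = dimCoker (B ∘ₗ (LinearMap.ker L).subtype) := by
  let φ : Y × Z →ₗ[ℂ] Z ⧸ LinearMap.range (B ∘ₗ (LinearMap.ker L).subtype) :=
    Submodule.mkQ _ ∘ₗ (LinearMap.snd ℂ Y Z - B ∘ₗ R ∘ₗ LinearMap.fst ℂ Y Z)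
  have hφ : Function.Surjective φ := fun z => by
    obtain ⟨z, rfl⟩ := Submodule.mkQ_surjective _ z
    exact ⟨(0, z), by simp [φ]⟩
  have hker : LinearMap.ker φ = LinearMap.range (L.prod B) := by
    ext ⟨f, c⟩
    have h : φ (f, c) = Submodule.Quotient.mk (c - B (R f)) := rfl
    rw [LinearMap.mem_ker, h, Submodule.Quotient.mk_eq_zero]
    constructor
    · rintro ⟨x, hx⟩
      have hx' : B x.1 = c - B (R f) := hx
      refine ⟨x.1 + R f, Prod.ext ?_ ?_⟩
      · simp [hR]
      · simp [hx']
    · rintro ⟨x, hx⟩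
      obtain ⟨h1, h2⟩ := Prod.ext_iff.1 hx
      simp only [LinearMap.prod_apply, Function.prod_apply] at h1 h2
      refine ⟨⟨x - R f, ?_⟩, ?_⟩
      · rw [LinearMap.mem_ker, map_sub, hR, h1, sub_self]
      · simp [h2]
  rw [dimCoker, dimCoker, ← hker]
  exact (φ.quotKerEquivOfSurjective hφ).rank_eq

theorem dimKer_comp_equiv (g : X →ₗ[ℂ] Z) (e : N ≃ₗ[ℂ] X) :
    dimKer (g ∘ₗ e.toLinearMap) = dimKer g :=
  LinearEquiv.rank_eq (e.ofSubmodules _ _ (by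
    ext x
    simp only [Submodule.mem_map, LinearMap.mem_ker, LinearMap.comp_apply]
    exact ⟨by rintro ⟨y, hy, rfl⟩; exact hy, fun hx => ⟨e.symm x, by simpa using hx, by simp⟩⟩))

theorem dimCoker_comp_equiv (g : X →ₗ[ℂ] Z) (e : N ≃ₗ[ℂ] X) :
    dimCoker (g ∘ₗ e.toLinearMap) = dimCoker g := by
  rw [dimCoker, dimCoker, LinearMap.range_comp_of_range_eq_top _ (LinearEquiv.range e)]

/-- In both cases dimension plus rank is the dimension of a fixed space (`N` for kernels, `Z` for
cokernels). The rank of `g` is finite, so it can be cancelled even though the kernels may have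
infinite cardinal dimension. -/
theorem dim_le_of_rank_le [Module.Finite ℂ Z] (g g' : N →ₗ[ℂ] Z)
    (h : Module.rank ℂ (LinearMap.range g) ≤ Module.rank ℂ (LinearMap.range g')) :
    dimKer g' ≤ dimKer g ∧ dimCoker g' ≤ dimCoker g := by
  have hfin : Module.rank ℂ (LinearMap.range g) < Cardinal.aleph0 := Module.rank_lt_aleph0 _ _
  constructor
  · rw [← Cardinal.add_le_add_iff_of_lt_aleph0 hfin, dimKer, dimKer]
    calc _ ≤ Module.rank ℂ (LinearMap.ker g') + Module.rank ℂ (LinearMap.range g') := by gcongr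
      _ = _ := by
        rw [add_comm, LinearMap.rank_range_add_rank_ker, add_comm,
          LinearMap.rank_range_add_rank_ker]
  · rw [← Cardinal.add_le_add_iff_of_lt_aleph0 hfin, dimCoker, dimCoker]
    calc _ ≤ Module.rank ℂ (Z ⧸ LinearMap.range g') + Module.rank ℂ (LinearMap.range g') := by
          gcongr
      _ = _ := by rw [Submodule.rank_quotient_add_rank, Submodule.rank_quotient_add_rank]

/-- If `R` and `R'` are right inverses of `L` and `L'` with the same range, then the projection
along this range identifies the kernels of `L` and `L'`. -/
def kerEquiv (L L' : X →ₗ[ℂ] Y) (R R' : Y →ₗ[ℂ] X) (hR : ∀ y, L (R y) = y)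
    (hR' : ∀ y, L' (R' y) = y) (h : ∀ y, R' (L' (R y)) = R y) (h' : ∀ y, R (L (R' y)) = R' y) :
    LinearMap.ker L ≃ₗ[ℂ] LinearMap.ker L' where
  toFun v := ⟨v.1 - R' (L' v.1), by rw [LinearMap.mem_ker, map_sub, hR', sub_self]⟩
  map_add' v w := Subtype.ext (by
    change (v.1 + w.1) - R' (L' (v.1 + w.1)) = (v.1 - R' (L' v.1)) + (w.1 - R' (L' w.1))
    rw [map_add, map_add]; abel)
  map_smul' c v := Subtype.ext (by
    change c • v.1 - R' (L' (c • v.1)) = c • (v.1 - R' (L' v.1))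
    rw [map_smul, map_smul, smul_sub])
  invFun v := ⟨v.1 - R (L v.1), by rw [LinearMap.mem_ker, map_sub, hR, sub_self]⟩
  left_inv v := Subtype.ext (by
    have hv : L v.1 = 0 := v.2
    change (v.1 - R' (L' v.1)) - R (L (v.1 - R' (L' v.1))) = v.1
    -- As `L v = 0` and `R L R' = R'`, the second correction is `-R' (L' v)` and undoes the first.
    rw [map_sub, map_sub, h', hv, map_zero]; abel)
  right_inv v := Subtype.ext (by
    have hv : L' v.1 = 0 := v.2
    change (v.1 - R (L v.1)) - R' (L' (v.1 - R (L v.1))) = v.1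
    rw [map_sub, map_sub, h, hv, map_zero]; abel)

theorem dimKer_eq_zero_iff (T : X →ₗ[ℂ] Y) : dimKer T = 0 ↔ Function.Injective T := by
  rw [dimKer, Submodule.rank_eq_zero, LinearMap.ker_eq_bot]

theorem dimCoker_eq_zero_iff (T : X →ₗ[ℂ] Y) : dimCoker T = 0 ↔ Function.Surjective T := by
  rw [dimCoker, rank_zero_iff, Submodule.Quotient.subsingleton_iff, LinearMap.range_eq_top]

end Algebra

/-! ### Semicontinuity of kernel and cokernel dimensions -/

section Semicontinuity

/-- The rank of operators with values in a finite-dimensional space is lower semicontinuous with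
respect to pointwise convergence. -/
theorem eventually_rank_range_le {N Z : Type} [AddCommGroup N] [Module ℂ N]
    [NormedAddCommGroup Z] [NormedSpace ℂ Z] [FiniteDimensional ℂ Z]
    (g : N →ₗ[ℂ] Z) (gk : ℕ → N →ₗ[ℂ] Z)
    (h : ∀ v, Tendsto (fun k => gk k v) atTop (𝓝 (g v))) :
    ∀ᶠ k in atTop, Module.rank ℂ (LinearMap.range g) ≤ Module.rank ℂ (LinearMap.range (gk k)) := by
  let β := Module.finBasis ℂ (LinearMap.range g)
  choose v hv using fun i => (β i).2
  have hli : LinearIndependent ℂ fun i => g (v i) := by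
    have h1 := β.linearIndependent.map' (LinearMap.range g).subtype (Submodule.ker_subtype _)
    exact (funext hv : (fun i => g (v i)) = (LinearMap.range g).subtype ∘ β) ▸ h1
  have ht : Tendsto (fun k i => gk k (v i)) atTop (𝓝 fun i => g (v i)) :=
    tendsto_pi_nhds.2 fun i => h (v i)
  -- Preimages `v i` of a basis of the range of `g` are fixed. Linear independence of a finite
  -- family is an open condition, so the vectors `gk k (v i)` are eventually independent.
  filter_upwards [ht.eventually (isOpen_setOfPred_linearIndependent.mem_nhds hli)] with k hk
  have h2 : LinearIndependent ℂ fun i => (⟨gk k (v i), v i, rfl⟩ : LinearMap.range (gk k)) :=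
    LinearIndependent.of_comp (LinearMap.range (gk k)).subtype hk
  have h3 := h2.cardinal_le_rank
  rw [← Module.finrank_eq_rank]
  simpa using h3

variable {X Y Z : Type} [NormedAddCommGroup X] [NormedSpace ℂ X] [CompleteSpace X]
  [NormedAddCommGroup Y] [NormedSpace ℂ Y] [CompleteSpace Y]
  [NormedAddCommGroup Z] [NormedSpace ℂ Z]

/-- Banach–Steinhaus bounds the norms of `Bk` uniformly, which makes `Bk k (xk k - x)` tend to zero.
-/
theorem tendsto_apply_of_tendsto_pointwise {B : X →L[ℂ] Z} {Bk : ℕ → X →L[ℂ] Z}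
    (hB : ∀ x, Tendsto (fun k => Bk k x) atTop (𝓝 (B x))) {x : X} {xk : ℕ → X}
    (hx : Tendsto xk atTop (𝓝 x)) : Tendsto (fun k => Bk k (xk k)) atTop (𝓝 (B x)) := by
  obtain ⟨C, hC⟩ := banach_steinhaus (g := Bk) fun x => by
    obtain ⟨C, hC⟩ := (hB x).norm.bddAbove_range
    exact ⟨C, fun k => hC ⟨k, rfl⟩⟩
  have h0 : Tendsto (fun k => Bk k (xk k - x)) atTop (𝓝 0) := by
    have h1 : Tendsto (fun k => C * ‖xk k - x‖) atTop (𝓝 0) := by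
      have := ((hx.sub_const x).norm).const_mul C
      simpa using this
    exact squeeze_zero_norm (fun k => (Bk k).le_of_opNorm_le (hC k) _) h1
  have h2 := h0.add (hB x)
  rw [zero_add] at h2
  exact h2.congr fun k => by rw [map_sub, sub_add_cancel]

/-- Upper semicontinuity of the dimensions of the kernel and the cokernel of `(L, B)`, when `L`
converges in norm to an operator with a right inverse and `B`, with finite-dimensional values,
converges strongly. -/
theorem eventually_dim_le [FiniteDimensional ℂ Z] {L : X →L[ℂ] Y} {Lk : ℕ → X →L[ℂ] Y}
    {B : X →L[ℂ] Z} {Bk : ℕ → X →L[ℂ] Z} (hL : Tendsto Lk atTop (𝓝 L))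
    (hB : ∀ x, Tendsto (fun k => Bk k x) atTop (𝓝 (B x)))
    (R : Y →L[ℂ] X) (hR : ∀ y, L (R y) = y) :
    ∀ᶠ k in atTop,
      dimKer ((Lk k : X →ₗ[ℂ] Y).prod (Bk k : X →ₗ[ℂ] Z)) ≤
        dimKer ((L : X →ₗ[ℂ] Y).prod (B : X →ₗ[ℂ] Z)) ∧
      dimCoker ((Lk k : X →ₗ[ℂ] Y).prod (Bk k : X →ₗ[ℂ] Z)) ≤
        dimCoker ((L : X →ₗ[ℂ] Y).prod (B : X →ₗ[ℂ] Z)) := by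
  have hLR : L ∘L R = 1 := ContinuousLinearMap.ext hR
  have hU : Tendsto (fun k => Lk k ∘L R) atTop (𝓝 (1 : Y →L[ℂ] Y)) := by
    rw [← hLR]
    exact ((continuous_id.clm_comp continuous_const).tendsto L).comp hL
  have hunit : ∀ᶠ k in atTop, IsUnit (Lk k ∘L R) :=
    hU.eventually (Units.isOpen.mem_nhds isUnit_one)
  have hV : Tendsto (fun k => Ring.inverse (Lk k ∘L R)) atTop (𝓝 (1 : Y →L[ℂ] Y)) := by
    have h1 := NormedRing.inverse_continuousAt (1 : (Y →L[ℂ] Y)ˣ)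
    rw [Units.val_one] at h1
    have h2 := h1.tendsto
    rw [Ring.inverse_one] at h2
    exact h2.comp hU
  -- When `Lk k ∘L R` is invertible, this is the projection onto `ker (Lk k)` along the range of
  -- `R`, restricted to `ker L`. For other `k` the value `Ring.inverse = 0` is harmless, as only
  -- large `k` matter. Since `Lk k v → L v = 0` on `ker L`, the maps tend pointwise to the
  -- inclusion.
  let Φ : ℕ → LinearMap.ker (L : X →ₗ[ℂ] Y) →ₗ[ℂ] X := fun k =>
    ((1 : X →L[ℂ] X) - R ∘L Ring.inverse (Lk k ∘L R) ∘L Lk k : X →L[ℂ] X).toLinearMap ∘ₗ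
      (LinearMap.ker (L : X →ₗ[ℂ] Y)).subtype
  have hΦ : ∀ v, Tendsto (fun k => Φ k v) atTop (𝓝 v.1) := by
    intro v
    have h0 : L v.1 = 0 := v.2
    have h1 : Tendsto (fun k => Lk k v.1) atTop (𝓝 0) := by
      rw [← h0]
      exact ((ContinuousLinearMap.apply ℂ Y v.1).continuous.tendsto L).comp hL
    have h2 : Tendsto (fun k => R (Ring.inverse (Lk k ∘L R) (Lk k v.1))) atTop (𝓝 0) := by
      have h3 : Tendsto (fun k => Ring.inverse (Lk k ∘L R) (Lk k v.1)) atTop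
          (𝓝 ((1 : Y →L[ℂ] Y) 0)) :=
        (isBoundedBilinearMap_apply.continuous.tendsto ((1 : Y →L[ℂ] Y), (0 : Y))).comp
          (hV.prodMk_nhds h1)
      have h4 := (R.continuous.tendsto _).comp h3
      rw [map_zero, map_zero] at h4
      exact h4
    have h4 := h2.const_sub v.1
    rw [sub_zero] at h4
    exact h4
  have hrank := eventually_rank_range_le
    ((B : X →ₗ[ℂ] Z) ∘ₗ (LinearMap.ker (L : X →ₗ[ℂ] Y)).subtype)
    (fun k => (Bk k : X →ₗ[ℂ] Z) ∘ₗ Φ k)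
    fun v => tendsto_apply_of_tendsto_pointwise hB (hΦ v)
  filter_upwards [hunit, hrank] with k hk hrk
  have hinv : ∀ y, Ring.inverse (Lk k ∘L R) (Lk k (R y)) = y := fun y =>
    congrArg (fun T : Y →L[ℂ] Y => T y) (Ring.inverse_mul_cancel _ hk)
  have hinv' : ∀ y, Lk k (R (Ring.inverse (Lk k ∘L R) y)) = y := fun y =>
    congrArg (fun T : Y →L[ℂ] Y => T y) (Ring.mul_inverse_cancel _ hk)
  let e := kerEquiv (L : X →ₗ[ℂ] Y) (Lk k : X →ₗ[ℂ] Y) (R : Y →ₗ[ℂ] X)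
    (R ∘L Ring.inverse (Lk k ∘L R) : Y →L[ℂ] X).toLinearMap hR hinv'
    (fun y => congrArg R (hinv y)) (fun y => congrArg R (hR _))
  -- The map of `e` has the same formula as `Φ k`, so the rank estimate on `ker L` is one for `Bk k`
  -- restricted to `ker (Lk k)`.
  have he : (Bk k : X →ₗ[ℂ] Z) ∘ₗ Φ k =
      ((Bk k : X →ₗ[ℂ] Z) ∘ₗ (LinearMap.ker (Lk k : X →ₗ[ℂ] Y)).subtype) ∘ₗ e.toLinearMap := rfl
  rw [he] at hrk
  have h := dim_le_of_rank_le _ _ hrk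
  rw [dimKer_comp_equiv, dimCoker_comp_equiv] at h
  rw [dimKer_prod, dimKer_prod,
    dimCoker_prod (L : X →ₗ[ℂ] Y) (B : X →ₗ[ℂ] Z) (R : Y →ₗ[ℂ] X) hR,
    dimCoker_prod (Lk k : X →ₗ[ℂ] Y) (Bk k : X →ₗ[ℂ] Z)
      (R ∘L Ring.inverse (Lk k ∘L R) : Y →L[ℂ] X).toLinearMap hinv']
  exact h

theorem isInvertibleOp_of_bijective (T : X →L[ℂ] Y) (h : Function.Bijective T) :
    IsInvertibleOp (T : X →ₗ[ℂ] Y) :=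
  ⟨ContinuousLinearEquiv.ofBijective T (LinearMap.ker_eq_bot.2 h.1)
    (LinearMap.range_eq_top.2 h.2), fun _ => rfl⟩

end Semicontinuity

/-! ### Finite sums of `L_p` classes -/

section Sum

variable {a b : ℝ} {p : ℝ≥0∞}

theorem Lp_coeFn_sum {ι : Type*} (s : Finset ι) (f : ι → Lp ℂ p (intervalMeasure a b)) :
    (∑ i ∈ s, f i : Lp ℂ p (intervalMeasure a b)) =ᵐ[intervalMeasure a b]
      fun x => ∑ i ∈ s, f i x := by
  classical
  induction s using Finset.induction_on with
  | empty => simp only [Finset.sum_empty]; exact Lp.coeFn_zero ℂ p (intervalMeasure a b)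
  | insert i s hi ih =>
    rw [Finset.sum_insert hi]
    filter_upwards [ih, Lp.coeFn_add (f i) (∑ i ∈ s, f i)] with x h1 h2
    rw [h2, Pi.add_apply, h1, Finset.sum_insert hi]

end Sum

/-! ### Composition of the differential operator with iterated integration -/

section Iterated

variable {a b : ℝ} {p : ℝ≥0∞} [Fact (1 ≤ p)] {n m r : ℕ}

/-- The `r`-fold integration from `a`, as an operator from `W_p^n` to `W_p^{n+r}`. -/
def integPow (hab : a < b) (p : ℝ≥0∞) [Fact (1 ≤ p)] (n : ℕ) :
    (r : ℕ) → sobolevSpace hab p n →L[ℂ] sobolevSpace hab p (n + r)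
  | 0 => ContinuousLinearMap.id ℂ _
  | r + 1 => integOp hab p (n + r) ∘L integPow hab p n r

theorem integPow_coord (hab : a < b) (u : sobolevSpace hab p n) (j : ℕ) (hj : j ≤ r) :
    (integPow hab p n r u).1 ⟨j, by omega⟩ = (volterra hab p)^[r - j] (u.1 0) := by
  induction r generalizing j with
  | zero =>
    obtain rfl : j = 0 := by omega
    rfl
  | succ r ih =>
    cases j with
    | zero =>
      have h := integOp_zero (integPow hab p n r u)
      rw [Nat.sub_zero, Function.iterate_succ_apply']
      have h0 := ih 0 (Nat.zero_le r)
      rw [Nat.sub_zero] at h0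
      rw [← h0]
      exact h
    | succ j =>
      rw [Nat.add_sub_add_right, ← ih j (by omega)]
      exact integOp_succ (integPow hab p n r u) ⟨j, by omega⟩

/-- The zeroth coordinate, as a linear map. -/
def coordZero (hab : a < b) (p : ℝ≥0∞) [Fact (1 ≤ p)] (q : ℕ) :
    sobolevSpace hab p q →ₗ[ℂ] Lp ℂ p (intervalMeasure a b) where
  toFun u := u.1 0
  map_add' _ _ := rfl
  map_smul' _ _ := rfl

theorem iterDeriv_integPow_coord (hab : a < b) {q : ℕ} (u : sobolevSpace hab p n) (j : ℕ)
    (h : q + j ≤ n + r) (hj : j ≤ r) :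
    (iterDeriv j h (integPow hab p n r u)).1 0 = (volterra hab p)^[r - j] (u.1 0) := by
  rw [← integPow_coord hab u j hj]
  have e : (⟨((0 : Fin (q + 1)) : ℕ) + j, by simp; omega⟩ : Fin (n + r + 1)) = ⟨j, by omega⟩ := by
    ext; simp
  exact congrArg (integPow hab p n r u).1 e

/-- The `j`-th derivative undoes `j` of the `r` integrations. The leading term thus becomes the
identity, and each lower-order term retains `r - j ≥ 1` integrations. -/
theorem diffOp_integPow_ae {hab : a < b}
    (A : Fin r → Matrix (Fin m) (Fin m) (sobolevSpace hab p n))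
    (u : Fin m → sobolevSpace hab p n) (i : Fin m) :
    (diffOp A (fun s => integPow hab p n r (u s)) i).1 0 =ᵐ[intervalMeasure a b] fun x =>
      (u i).1 0 x + ∑ j : Fin r, ∑ s : Fin m,
        (A j i s).1 0 x * (volterra hab p)^[r - j] ((u s).1 0) x := by
  let w : Fin r → Fin m → sobolevSpace hab p n := fun j s =>
    mulOp (A j i s) (iterDeriv (j : ℕ) (by omega) (integPow hab p n r (u s)))
  have h1 : coordZero hab p n (diffOp A (fun s => integPow hab p n r (u s)) i) =
      (u i).1 0 + ∑ j : Fin r, ∑ s : Fin m, (w j s).1 0 := by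
    rw [diffOp_apply, map_add, map_sum]
    refine congrArg₂ (· + ·) ?_ (Finset.sum_congr rfl fun j _ => map_sum _ _ _)
    refine (iterDeriv_integPow_coord hab (u i) r le_rfl le_rfl).trans ?_
    rw [Nat.sub_self, Function.iterate_zero_apply]
  have h2 : ∀ᵐ x ∂(intervalMeasure a b), ∀ j s, (w j s).1 0 x =
      (A j i s).1 0 x * (volterra hab p)^[r - j] ((u s).1 0) x := by
    refine ae_all_iff.2 fun j => ae_all_iff.2 fun s => ?_
    refine (mulOp_ae (A j i s) _).trans ?_
    rw [iterDeriv_integPow_coord hab (u s) j _ j.2.le]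
  have h3 : ∀ᵐ x ∂(intervalMeasure a b), ∀ j : Fin r,
      (∑ s : Fin m, (w j s).1 0 : Lp ℂ p (intervalMeasure a b)) x = ∑ s : Fin m, (w j s).1 0 x :=
    ae_all_iff.2 fun j => Lp_coeFn_sum _ _
  change coordZero hab p n (diffOp A (fun s => integPow hab p n r (u s)) i)
    =ᵐ[intervalMeasure a b] _
  rw [h1]
  filter_upwards [h2, h3, Lp.coeFn_add ((u i).1 0) (∑ j : Fin r, ∑ s : Fin m, (w j s).1 0),
    Lp_coeFn_sum Finset.univ fun j : Fin r => ∑ s : Fin m, (w j s).1 0] with x h2 h3 h4 h5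
  rw [h4, Pi.add_apply, h5]
  simp only [h3, h2]

end Iterated

/-! ### Pointwise Volterra estimates -/

section Estimates

variable {a b : ℝ} {p : ℝ≥0∞} [Fact (1 ≤ p)] {n m r : ℕ}

theorem integral_mono_upper {φ : ℝ → ℝ} (hφ : IntegrableOn φ (Icc a b)) (h0 : ∀ t, 0 ≤ φ t)
    {x y : ℝ} (hx : x ∈ Icc a b) (hy : y ∈ Icc a b) (hxy : x ≤ y) :
    ∫ t in a..x, φ t ≤ ∫ t in a..y, φ t :=
  intervalIntegral.integral_mono_interval le_rfl hx.1 hxy (Eventually.of_forall h0)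
    (intervalIntegrable_of_integrableOn hφ (left_mem_Icc.2 (hx.1.trans hx.2)) hy)

theorem integral_mono_ae_upper {φ ψ : ℝ → ℝ} (hφ : IntegrableOn φ (Icc a b))
    (hψ : IntegrableOn ψ (Icc a b)) (h : φ ≤ᵐ[intervalMeasure a b] ψ) {x : ℝ} (hx : x ∈ Icc a b) :
    ∫ t in a..x, φ t ≤ ∫ t in a..x, ψ t := by
  have ha : a ∈ Icc a b := left_mem_Icc.2 (hx.1.trans hx.2)
  refine intervalIntegral.integral_mono_ae_restrict hx.1
    (intervalIntegrable_of_integrableOn hφ ha hx) (intervalIntegrable_of_integrableOn hψ ha hx) ?_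
  exact ae_restrict_of_ae_restrict_of_subset (Icc_subset_Icc_right hx.2) h

/-- Since `∫_a^x ‖f‖` increases with `x`, each further integration costs at most a factor `b - a`.
Keeping the upper limit `x` preserves the Volterra structure that later produces factorials. -/
theorem norm_iterate_volterra_le (hab : a < b) (f : Lp ℂ p (intervalMeasure a b)) (i : ℕ) :
    ∀ᵐ x ∂(intervalMeasure a b),
      ‖(volterra hab p)^[i + 1] f x‖ ≤ (b - a) ^ i * ∫ t in a..x, ‖f t‖ := by
  have hf : IntegrableOn (fun t => ‖f t‖) (Icc a b) := (Lp_integrableOn f).norm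
  induction i with
  | zero =>
    filter_upwards [volterra_ae hab f, ae_restrict_mem measurableSet_Icc] with x h1 hx
    rw [zero_add, Function.iterate_one, h1, pow_zero, one_mul]
    exact intervalIntegral.norm_integral_le_integral_norm hx.1
  | succ i ih =>
    filter_upwards [volterra_ae hab ((volterra hab p)^[i + 1] f),
      ae_restrict_mem measurableSet_Icc] with x h1 hx
    rw [Function.iterate_succ_apply', h1]
    refine (intervalIntegral.norm_integral_le_integral_norm hx.1).trans ?_
    have ha : a ∈ Icc a b := left_mem_Icc.2 hab.le
    have hS : 0 ≤ ∫ t in a..x, ‖f t‖ :=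
      intervalIntegral.integral_nonneg hx.1 fun t _ => norm_nonneg _
    have hba : 0 ≤ b - a := by linarith
    have h2 : ∫ t in a..x, ‖(volterra hab p)^[i + 1] f t‖ ≤
        ∫ _ in a..x, (b - a) ^ i * ∫ t in a..x, ‖f t‖ := by
      refine intervalIntegral.integral_mono_ae_restrict hx.1
        (intervalIntegrable_of_integrableOn (Lp_integrableOn _).norm ha hx)
        intervalIntegrable_const ?_
      filter_upwards [ae_restrict_of_ae_restrict_of_subset (Icc_subset_Icc_right hx.2) ih,
        ae_restrict_mem measurableSet_Icc] with t h3 ht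
      refine h3.trans (mul_le_mul_of_nonneg_left ?_ (by positivity))
      exact integral_mono_upper hf (fun _ => norm_nonneg _) ⟨ht.1, ht.2.trans hx.2⟩ hx ht.2
    refine h2.trans ?_
    rw [intervalIntegral.integral_const, smul_eq_mul, pow_succ]
    have h3 : x - a ≤ b - a := by linarith [hx.2]
    calc (x - a) * ((b - a) ^ i * ∫ t in a..x, ‖f t‖)
        ≤ (b - a) * ((b - a) ^ i * ∫ t in a..x, ‖f t‖) := by gcongr
      _ = _ := by ring

theorem ac_primitive_real (hab : a ≤ b) {φ : ℝ → ℝ} (hφ : IntegrableOn φ (Icc a b)) {x : ℝ}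
    (hx : x ∈ Icc a b) : AbsolutelyContinuousOnInterval (fun x => ∫ t in a..x, φ t) a x :=
  (intervalIntegrable_of_integrableOn hφ (left_mem_Icc.2 hab)
    hx).absolutelyContinuousOnInterval_intervalIntegral left_mem_uIcc

/-- The integrand is almost everywhere the derivative of the right-hand side, which is absolutely
continuous; hence integrability of `φ` suffices for the fundamental theorem. -/
theorem integral_mul_primitive_pow (hab : a ≤ b) {φ : ℝ → ℝ} (hφ : IntegrableOn φ (Icc a b))
    (k : ℕ) {x : ℝ} (hx : x ∈ Icc a b) :
    ∫ t in a..x, φ t * ((∫ s in a..t, φ s) ^ k / k.factorial) =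
      (∫ s in a..x, φ s) ^ (k + 1) / (k + 1).factorial := by
  have hac : ∀ k : ℕ, AbsolutelyContinuousOnInterval (fun x => (∫ t in a..x, φ t) ^ (k + 1)) a x := by
    intro k
    induction k with
    | zero => simpa using ac_primitive_real hab hφ hx
    | succ k ih =>
      simp only [pow_succ _ (k + 1)]
      exact ih.fun_mul (ac_primitive_real hab hφ hx)
  have h := (hac k).integral_deriv_eq_sub
  simp only [intervalIntegral.integral_same, ne_eq, Nat.succ_ne_zero, not_false_eq_true, zero_pow,
    sub_zero] at h
  rw [← h, div_eq_inv_mul, ← intervalIntegral.integral_const_mul]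
  refine intervalIntegral.integral_congr_ae ?_
  filter_upwards [(intervalIntegrable_of_integrableOn hφ (left_mem_Icc.2 hab)
    hx).ae_hasDerivAt_integral] with t ht ht'
  have h1 := ((ht (uIoc_subset_uIcc ht') a left_mem_uIcc).pow (k + 1)).deriv
  have h2 : deriv (fun x => (∫ t in a..x, φ t) ^ (k + 1)) t =
      ((k + 1 : ℕ) : ℝ) * (∫ s in a..t, φ s) ^ k * φ t := h1
  rw [h2, Nat.factorial_succ]
  have h3 : (k.factorial : ℝ) ≠ 0 := by positivity
  push_cast
  field_simp

theorem norm_eq_norm_coord_zero {hab : a < b} (u : sobolevSpace hab p 0) : ‖u‖ = ‖u.1 0‖ := by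
  rw [Submodule.coe_norm, PiLp.norm_eq_of_L1]
  simp

end Estimates

/-! ### Factorial decay of iterates and invertibility in `L_p` -/

section QuasiNilpotent

variable {a b : ℝ} {p : ℝ≥0∞} [Fact (1 ≤ p)] {m : ℕ}

/-- The pointwise sum of the absolute values of the components. -/
def sumNorm {hab : a < b} (u : Fin m → sobolevSpace hab p 0) (t : ℝ) : ℝ := ∑ i, ‖(u i).1 0 t‖

theorem sumNorm_nonneg {hab : a < b} (u : Fin m → sobolevSpace hab p 0) (t : ℝ) :
    0 ≤ sumNorm u t := Finset.sum_nonneg fun _ _ => norm_nonneg _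

theorem integrableOn_sumNorm {hab : a < b} (u : Fin m → sobolevSpace hab p 0) :
    IntegrableOn (sumNorm u) (Icc a b) :=
  integrable_finsetSum _ fun i _ => (Lp_integrableOn ((u i).1 0)).norm

theorem exists_integral_sumNorm_le (hab : a < b) (p : ℝ≥0∞) [Fact (1 ≤ p)] (m : ℕ) :
    ∃ C : ℝ, 0 ≤ C ∧ ∀ u : Fin m → sobolevSpace hab p 0,
      ∫ t in a..b, sumNorm u t ≤ C * ‖u‖ := by
  obtain ⟨C, hC, h⟩ := exists_integral_norm_le hab p
  refine ⟨m * C, by positivity, fun u => ?_⟩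
  have e : ∫ t in a..b, sumNorm u t = ∑ i, ∫ t in a..b, ‖(u i).1 0 t‖ :=
    intervalIntegral.integral_finsetSum fun i _ => intervalIntegrable_of_integrableOn
      (Lp_integrableOn ((u i).1 0)).norm (left_mem_Icc.2 hab.le) (right_mem_Icc.2 hab.le)
  rw [e]
  calc ∑ i, ∫ t in a..b, ‖(u i).1 0 t‖ ≤ ∑ _i : Fin m, C * ‖u‖ := by
        refine Finset.sum_le_sum fun i _ => (h _).trans ?_
        rw [← norm_eq_norm_coord_zero]
        exact mul_le_mul_of_nonneg_left (norm_le_pi_norm u i) hC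
    _ = m * C * ‖u‖ := by simp [mul_assoc]

variable {hab : a < b} (M : (Fin m → sobolevSpace hab p 0) → Fin m → sobolevSpace hab p 0)
  {α : ℝ → ℝ}

/-- Picard iteration: inserting the bound for one iterate into `H` integrates `α Γ^k / k!`, where
`Γ` is the primitive of `α`, and gives `Γ^(k+1) / (k+1)!`. -/
theorem sumNorm_iterate_le (hα0 : ∀ t, 0 ≤ α t) (hα : MemLp α p (intervalMeasure a b))
    (H : ∀ u, ∀ᵐ x ∂(intervalMeasure a b), sumNorm (M u) x ≤ α x * ∫ t in a..x, sumNorm u t)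
    (u : Fin m → sobolevSpace hab p 0) (k : ℕ) :
    ∀ᵐ x ∂(intervalMeasure a b), sumNorm (M^[k + 1] u) x ≤
      α x * ((∫ t in a..x, α t) ^ k / k.factorial) * ∫ t in a..b, sumNorm u t := by
  have hαi : IntegrableOn α (Icc a b) := hα.integrable Fact.out
  have ha : a ∈ Icc a b := left_mem_Icc.2 hab.le
  have hb : b ∈ Icc a b := right_mem_Icc.2 hab.le
  induction k with
  | zero =>
    filter_upwards [H u, ae_restrict_mem measurableSet_Icc] with x h hx
    change sumNorm (M u) x ≤ _
    refine h.trans ?_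
    simp only [pow_zero, Nat.factorial_zero, Nat.cast_one, div_one, mul_one]
    exact mul_le_mul_of_nonneg_left (integral_mono_upper (integrableOn_sumNorm u)
      (sumNorm_nonneg u) hx hb hx.2) (hα0 x)
  | succ k ih =>
    filter_upwards [H (M^[k + 1] u), ae_restrict_mem measurableSet_Icc] with x h hx
    rw [Function.iterate_succ_apply', mul_assoc]
    refine h.trans (mul_le_mul_of_nonneg_left ?_ (hα0 x))
    rw [← integral_mul_primitive_pow hab.le hαi k hx, ← intervalIntegral.integral_mul_const]
    refine integral_mono_ae_upper (integrableOn_sumNorm _) ?_ ih hx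
    refine Integrable.mul_const ?_ _
    have hc : ContinuousOn (fun x => (∫ t in a..x, α t) ^ k / k.factorial) (Icc a b) := by
      have h1 := (ac_primitive_real hab.le hαi hb).continuousOn
      rw [uIcc_of_le hab.le] at h1
      exact (h1.pow k).div_const _
    exact hαi.mul_continuousOn hc isCompact_Icc

theorem exists_norm_iterate_le (hα0 : ∀ t, 0 ≤ α t) (hα : MemLp α p (intervalMeasure a b))
    (H : ∀ u, ∀ᵐ x ∂(intervalMeasure a b), sumNorm (M u) x ≤ α x * ∫ t in a..x, sumNorm u t) :
    ∃ D : ℝ, ∀ (k : ℕ) u, ‖M^[k + 1] u‖ ≤ (∫ t in a..b, α t) ^ k / k.factorial * D * ‖u‖ := by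
  have hαi : IntegrableOn α (Icc a b) := hα.integrable Fact.out
  have hb : b ∈ Icc a b := right_mem_Icc.2 hab.le
  obtain ⟨C, hC, hI⟩ := exists_integral_sumNorm_le hab p m
  have hΓ : 0 ≤ ∫ t in a..b, α t := intervalIntegral.integral_nonneg hab.le fun t _ => hα0 t
  -- `C` bounds the integral of `sumNorm u` by `‖u‖`; the norm of `α` comes from the factor `α x`
  -- left in the pointwise bound.
  refine ⟨C * ‖hα.toLp α‖, fun k u => (pi_norm_le_iff_of_nonneg (by positivity)).2 fun i => ?_⟩
  have hIu : 0 ≤ ∫ t in a..b, sumNorm u t :=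
    intervalIntegral.integral_nonneg hab.le fun t _ => sumNorm_nonneg u t
  rw [norm_eq_norm_coord_zero]
  have h1 : ‖(M^[k + 1] u i).1 0‖ ≤
      ((∫ t in a..b, α t) ^ k / k.factorial * ∫ t in a..b, sumNorm u t) * ‖hα.toLp α‖ := by
    refine Lp.norm_le_mul_norm_of_ae_le_mul ?_
    filter_upwards [sumNorm_iterate_le M hα0 hα H u k, ae_restrict_mem measurableSet_Icc,
      hα.coeFn_toLp] with x h hx h'
    rw [h', Real.norm_eq_abs, abs_of_nonneg (hα0 x)]
    refine (Finset.single_le_sum (f := fun i => ‖(M^[k + 1] u i).1 0 x‖)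
      (fun _ _ => norm_nonneg _) (Finset.mem_univ i)).trans (h.trans ?_)
    have h2 : ∫ t in a..x, α t ≤ ∫ t in a..b, α t := integral_mono_upper hαi hα0 hx hb hx.2
    have h3 : 0 ≤ ∫ t in a..x, α t := intervalIntegral.integral_nonneg hx.1 fun t _ => hα0 t
    have h4 := hα0 x
    calc _ ≤ α x * ((∫ t in a..b, α t) ^ k / k.factorial) * ∫ t in a..b, sumNorm u t := by gcongr
      _ = _ := by ring
  refine h1.trans ?_
  have h5 := hI u
  calc _ ≤ ((∫ t in a..b, α t) ^ k / k.factorial * (C * ‖u‖)) * ‖hα.toLp α‖ := by gcongr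
    _ = _ := by ring

/-- The element `1 - (-x)^k` is a unit by the Neumann series, and it is the product of `1 + x` with
a commuting geometric sum, so both factors are units. -/
theorem isUnit_one_add_of_norm_pow_lt {R : Type*} [NormedRing R] [CompleteSpace R] {x : R} {k : ℕ}
    (h : ‖x ^ k‖ < 1) : IsUnit (1 + x) := by
  have h1 : IsUnit (1 - (-x) ^ k) := by
    refine (Units.oneSub ((-x) ^ k) ?_).isUnit
    rwa [neg_pow, (by rcases neg_one_pow_eq_or R k with h | h <;> simp [h] :
      ‖(-1 : R) ^ k * x ^ k‖ = ‖x ^ k‖)]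
  have hc : Commute (1 + x) (∑ i ∈ Finset.range k, (-x) ^ i) := by
    refine Commute.sum_right _ _ _ fun i _ => Commute.pow_right ?_ _
    exact (Commute.one_left _).add_left (Commute.refl x).neg_right
  have h2 := mul_neg_geom_sum (-x) k
  rw [sub_neg_eq_add] at h2
  rw [← h2] at h1
  exact (hc.isUnit_mul_iff.1 h1).1

/-- An operator is bijective if some iterate of its difference with the identity is a
contraction. -/
theorem bijective_of_norm_iterate_le {E : Type*} [NormedAddCommGroup E] [NormedSpace ℂ E]
    [CompleteSpace E] (T : E →L[ℂ] E) {c : ℝ} (hc0 : 0 ≤ c) (hc : c < 1) {k : ℕ}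
    (S : E → E) (hS : ∀ u, S u = T u - u) (h : ∀ u, ‖S^[k] u‖ ≤ c * ‖u‖) :
    Function.Bijective T := by
  obtain rfl : S = fun u => T u - u := funext hS
  have h1 : ‖(T - 1) ^ k‖ ≤ c := ContinuousLinearMap.opNorm_le_bound _ hc0 fun u => by
    rw [FunLike.coe_pow_eq_iterate]
    exact h u
  obtain ⟨U, hU⟩ := isUnit_one_add_of_norm_pow_lt (h1.trans_lt hc)
  rw [add_sub_cancel] at hU
  rw [← hU]
  exact ⟨Function.LeftInverse.injective (g := (↑U⁻¹ : E →L[ℂ] E)) fun x =>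
      congrArg (fun T : E →L[ℂ] E => T x) U.inv_mul,
    Function.RightInverse.surjective (g := (↑U⁻¹ : E →L[ℂ] E)) fun x =>
      congrArg (fun T : E →L[ℂ] E => T x) U.mul_inv⟩

/-- An operator whose difference with the identity is pointwise bounded by a Volterra operator is
bijective. -/
theorem bijective_of_sumNorm_le
    (T : (Fin m → sobolevSpace hab p 0) →L[ℂ] (Fin m → sobolevSpace hab p 0))
    (hα0 : ∀ t, 0 ≤ α t) (hα : MemLp α p (intervalMeasure a b))
    (H : ∀ u, ∀ᵐ x ∂(intervalMeasure a b),
      sumNorm (T u - u) x ≤ α x * ∫ t in a..x, sumNorm u t) :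
    Function.Bijective T := by
  obtain ⟨D, hD⟩ := exists_norm_iterate_le (fun u => T u - u) hα0 hα H
  -- The factorial beats any size of `∫ α`, so no smallness is needed. The absolute value supplies a
  -- nonnegative contraction constant, the sign of `D` being unknown.
  have ht : Tendsto (fun k : ℕ => |(∫ t in a..b, α t) ^ k / k.factorial * D|) atTop (𝓝 0) := by
    simpa using
      ((FloorSemiring.tendsto_pow_div_factorial_atTop (∫ t in a..b, α t)).mul_const D).abs
  obtain ⟨k, hk⟩ := (ht.eventually (gt_mem_nhds one_pos)).exists
  exact bijective_of_norm_iterate_le (E := Fin m → sobolevSpace hab p 0) T (abs_nonneg _) hk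
    (k := k + 1) (fun u => T u - u) (fun _ => rfl) fun u => (hD k u).trans (mul_le_mul_of_nonneg_right (le_abs_self _) (norm_nonneg _))

end QuasiNilpotent

/-! ### Sobolev regularity of almost-everywhere classes -/

section Representatives

variable {a b : ℝ} {p : ℝ≥0∞}

/-- A function agreeing almost everywhere with a function of `W_p^q`. -/
def HasSobolevRep (a b : ℝ) (p : ℝ≥0∞) (q : ℕ) (f : ℝ → ℂ) : Prop :=
  ∃ y, IsSobolev a b p q y ∧ f =ᵐ[intervalMeasure a b] y

theorem HasSobolevRep.mono (hab : a < b) {q q' : ℕ} {f : ℝ → ℂ} (h : HasSobolevRep a b p q' f)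
    (hq : q ≤ q') : HasSobolevRep a b p q f := by
  obtain ⟨y, hy, h⟩ := h
  exact ⟨y, hy.mono hab hq, h⟩

theorem HasSobolevRep.mul_same (hab : a < b) {q : ℕ} {f g : ℝ → ℂ}
    (hf : HasSobolevRep a b p (q + 1) f) (hg : HasSobolevRep a b p (q + 1) g) :
    HasSobolevRep a b p (q + 1) fun x => f x * g x := by
  obtain ⟨y, hy, h⟩ := hf
  obtain ⟨z, hz, h'⟩ := hg
  refine ⟨_, hy.mul_same hab hz, ?_⟩
  filter_upwards [h, h'] with x h1 h2
  rw [h1, h2]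

theorem HasSobolevRep.sum (hab : a < b) {q : ℕ} {ι : Type*} [Fintype ι] {f : ι → ℝ → ℂ}
    (h : ∀ i, HasSobolevRep a b p q (f i)) : HasSobolevRep a b p q fun x => ∑ i, f i x := by
  choose y hy h using h
  refine ⟨_, IsSobolev.sum hab Finset.univ fun i _ => hy i, ?_⟩
  filter_upwards [ae_all_iff.2 h] with x h
  exact Finset.sum_congr rfl fun i _ => h i

theorem HasSobolevRep.sub (hab : a < b) {q : ℕ} {f g : ℝ → ℂ}
    (hf : HasSobolevRep a b p q f) (hg : HasSobolevRep a b p q g) :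
    HasSobolevRep a b p q fun x => f x - g x := by
  obtain ⟨y, hy, h⟩ := hf
  obtain ⟨z, hz, h'⟩ := hg
  refine ⟨_, hy.add hab (hz.const_mul hab (-1)), ?_⟩
  filter_upwards [h, h'] with x h1 h2
  rw [h1, h2]
  ring

end Representatives

/-! ### Solvability in `W_p^n` and the right inverse -/

section Surjectivity

variable {a b : ℝ} {p : ℝ≥0∞} [Fact (1 ≤ p)] {n m r : ℕ} {hab : a < b}

/-- The composition of the differential operator with the `r`-fold integration. -/
def diffIntegOp (A : Fin r → Matrix (Fin m) (Fin m) (sobolevSpace hab p n)) :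
    (Fin m → sobolevSpace hab p n) →L[ℂ] (Fin m → sobolevSpace hab p n) :=
  diffOpL A ∘L ContinuousLinearMap.pi fun s =>
    integPow hab p n r ∘L ContinuousLinearMap.proj s

theorem diffIntegOp_ae (A : Fin r → Matrix (Fin m) (Fin m) (sobolevSpace hab p n))
    (u : Fin m → sobolevSpace hab p n) (i : Fin m) :
    (diffIntegOp A u i).1 0 =ᵐ[intervalMeasure a b] fun x =>
      (u i).1 0 x + ∑ j : Fin r, ∑ s : Fin m,
        (A j i s).1 0 x * (volterra hab p)^[r - j] ((u s).1 0) x := by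
  have h : diffIntegOp A u = diffOp A (fun s => integPow hab p n r (u s)) :=
    diffOpL_apply A _
  rw [h]
  exact diffOp_integPow_ae A u i

theorem bijective_diffIntegOp_zero (A : Fin r → Matrix (Fin m) (Fin m) (sobolevSpace hab p 0)) :
    Function.Bijective (diffIntegOp A) := by
  have hba : 0 ≤ b - a := by linarith
  -- The `r - j` integrations contribute `(b - a)^(r - j - 1)`, the last one being kept as `∫_a^x`.
  let α : ℝ → ℝ := fun x =>
    ∑ i : Fin m, ∑ j : Fin r, ∑ s : Fin m, (b - a) ^ (r - j - 1) * ‖(A j i s).1 0 x‖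
  have hα0 : ∀ t, 0 ≤ α t := fun t => Finset.sum_nonneg fun i _ => Finset.sum_nonneg fun j _ =>
    Finset.sum_nonneg fun s _ => by positivity
  have hα : MemLp α p (intervalMeasure a b) :=
    memLp_finsetSum _ fun i _ => memLp_finsetSum _ fun j _ => memLp_finsetSum _ fun s _ =>
      (Lp.memLp ((A j i s).1 0)).norm.const_mul _
  refine bijective_of_sumNorm_le (diffIntegOp A) hα0 hα fun u => ?_
  have h1 : ∀ᵐ x ∂(intervalMeasure a b), ∀ i, ((diffIntegOp A u - u) i).1 0 x =
      ∑ j : Fin r, ∑ s : Fin m,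
        (A j i s).1 0 x * (volterra hab p)^[r - j] ((u s).1 0) x := by
    refine ae_all_iff.2 fun i => ?_
    filter_upwards [diffIntegOp_ae A u i,
      Lp.coeFn_sub ((diffIntegOp A u i).1 0) ((u i).1 0)] with x h1 h2
    refine Eq.trans h2 ?_
    rw [Pi.sub_apply, h1, add_sub_cancel_left]
  have h2 : ∀ᵐ x ∂(intervalMeasure a b), ∀ (j : Fin r) (s : Fin m),
      ‖(volterra hab p)^[r - j] ((u s).1 0) x‖ ≤
        (b - a) ^ (r - j - 1) * ∫ t in a..x, ‖(u s).1 0 t‖ := by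
    refine ae_all_iff.2 fun j => ae_all_iff.2 fun s => ?_
    have h3 := norm_iterate_volterra_le hab ((u s).1 0) (r - j - 1)
    have e : r - (j : ℕ) - 1 + 1 = r - j := by omega
    rwa [e] at h3
  filter_upwards [h1, h2, ae_restrict_mem measurableSet_Icc] with x h1 h2 hx
  have h4 : ∀ s, ∫ t in a..x, ‖(u s).1 0 t‖ ≤ ∫ t in a..x, sumNorm u t := fun s =>
    integral_mono_ae_upper (Lp_integrableOn _).norm (integrableOn_sumNorm u)
      (Eventually.of_forall fun t => Finset.single_le_sum (f := fun i => ‖(u i).1 0 t‖)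
        (fun _ _ => norm_nonneg _) (Finset.mem_univ s)) hx
  simp only [α, Finset.sum_mul]
  refine Finset.sum_le_sum fun i _ => ?_
  rw [h1]
  refine (norm_sum_le _ _).trans (Finset.sum_le_sum fun j _ => (norm_sum_le _ _).trans
    (Finset.sum_le_sum fun s _ => ?_))
  rw [norm_mul]
  calc ‖(A j i s).1 0 x‖ * ‖(volterra hab p)^[r - j] ((u s).1 0) x‖
      ≤ ‖(A j i s).1 0 x‖ * ((b - a) ^ (r - j - 1) * ∫ t in a..x, sumNorm u t) := by
        refine mul_le_mul_of_nonneg_left ((h2 j s).trans ?_) (norm_nonneg _)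
        exact mul_le_mul_of_nonneg_left (h4 s) (by positivity)
    _ = _ := by ring

theorem hasSobolevRep_coord {q : ℕ} (u : sobolevSpace hab p q) :
    HasSobolevRep a b p q (u.1 0) :=
  ⟨rep u, rep_isSobolev u, rep_ae u⟩

theorem HasSobolevRep.exists_coord {q : ℕ} {f : Lp ℂ p (intervalMeasure a b)}
    (h : HasSobolevRep a b p q f) : ∃ v : sobolevSpace hab p q, v.1 0 = f := by
  obtain ⟨y, hy, h⟩ := h
  exact ⟨ofFun hab y hy, Lp.ext ((ofFun_ae y hy).trans h.symm)⟩

theorem HasSobolevRep.iterate_volterra {q : ℕ} {f : Lp ℂ p (intervalMeasure a b)}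
    (h : HasSobolevRep a b p q f) (i : ℕ) :
    HasSobolevRep a b p (q + i) ((volterra hab p)^[i] f) := by
  induction i with
  | zero => exact h
  | succ i ih =>
    obtain ⟨y, hy, h⟩ := ih
    refine ⟨_, hy.const_add_primitive Fact.out hab 0, ?_⟩
    rw [Function.iterate_succ_apply']
    filter_upwards [volterra_ae hab ((volterra hab p)^[i] f), ae_restrict_mem measurableSet_Icc]
      with x h1 hx
    rw [h1, zero_add, primitive_congr h hx]

/-- The inclusion of `W_p^q` in `L_p = W_p^0`. -/
def toZero {q : ℕ} (u : sobolevSpace hab p q) : sobolevSpace hab p 0 := iterDeriv 0 (Nat.zero_le q) u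

theorem toZero_coord {q : ℕ} (u : sobolevSpace hab p q) : (toZero u).1 0 = u.1 0 := rfl

theorem toZero_diffIntegOp (A : Fin r → Matrix (Fin m) (Fin m) (sobolevSpace hab p n))
    (u : Fin m → sobolevSpace hab p n) (i : Fin m) :
    toZero (diffIntegOp A u i) =
      diffIntegOp (fun j => (A j).map toZero) (fun s => toZero (u s)) i :=
  sobolevSpace_ext (Lp.ext ((diffIntegOp_ae A u i).trans
    (diffIntegOp_ae (fun j => (A j).map toZero) (fun s => toZero (u s)) i).symm))

/-- Injectivity is inherited from `L_p`. For surjectivity, the `L_p` solution is bootstrapped: in `u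
= f - ∑ A_j V^(r-j) u`, with `V` the Volterra operator, `u ∈ W_p^q` puts each `V^(r-j) u` in
`W_p^{q+1}`. This space is an algebra, so `u ∈ W_p^{q+1}` as long as `q + 1 ≤ n`. -/
theorem bijective_diffIntegOp (A : Fin r → Matrix (Fin m) (Fin m) (sobolevSpace hab p n)) :
    Function.Bijective (diffIntegOp A) := by
  have h0 := bijective_diffIntegOp_zero fun j => (A j).map toZero
  constructor
  · intro u v huv
    have h1 : (fun s => toZero (u s)) = fun s => toZero (v s) := by
      refine h0.1 (funext fun i => ?_)
      rw [← toZero_diffIntegOp, ← toZero_diffIntegOp, huv]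
    exact funext fun s => sobolevSpace_ext (by
      rw [← toZero_coord (u s), ← toZero_coord (v s), congrFun h1 s])
  · intro f
    obtain ⟨u, hu⟩ := h0.2 fun i => toZero (f i)
    have key : ∀ q, q ≤ n → ∀ i, HasSobolevRep a b p q ((u i).1 0) := by
      intro q
      induction q with
      | zero => exact fun _ i => hasSobolevRep_coord (u i)
      | succ q ih =>
        intro hq i
        have h2 : HasSobolevRep a b p (q + 1) fun x => (f i).1 0 x - ∑ j : Fin r, ∑ s : Fin m,
            (A j i s).1 0 x * (volterra hab p)^[r - j] ((u s).1 0) x := by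
          refine HasSobolevRep.sub hab ((hasSobolevRep_coord (f i)).mono hab hq)
            (HasSobolevRep.sum hab fun j => HasSobolevRep.sum hab fun s => ?_)
          exact HasSobolevRep.mul_same hab ((hasSobolevRep_coord (A j i s)).mono hab hq)
            (((ih (by omega) s).iterate_volterra (r - j)).mono hab (by omega))
        obtain ⟨y, hy, h2⟩ := h2
        refine ⟨y, hy, EventuallyEq.trans ?_ h2⟩
        have h3 := diffIntegOp_ae (fun j => (A j).map toZero) u i
        rw [hu] at h3
        filter_upwards [h3] with x h3
        exact eq_sub_of_add_eq h3.symm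
    choose v hv using fun i => (key n le_rfl i).exists_coord (hab := hab)
    have hv' : (fun s => toZero (v s)) = u := funext fun s => sobolevSpace_ext (hv s)
    refine ⟨v, funext fun i => sobolevSpace_ext ?_⟩
    rw [← toZero_coord (diffIntegOp A v i), toZero_diffIntegOp, hv', hu, toZero_coord]

/-- The differential operator has a continuous right inverse. -/
theorem exists_rightInverse_diffOpL
    (A : Fin r → Matrix (Fin m) (Fin m) (sobolevSpace hab p n)) :
    ∃ R : (Fin m → sobolevSpace hab p n) →L[ℂ] (Fin m → sobolevSpace hab p (n + r)),
      ∀ f, diffOpL A (R f) = f := by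
  have h := bijective_diffIntegOp A
  obtain ⟨e, he⟩ := isInvertibleOp_of_bijective (X := Fin m → sobolevSpace hab p n)
    (Y := Fin m → sobolevSpace hab p n) (diffIntegOp A) h
  exact ⟨(ContinuousLinearMap.pi fun s => integPow hab p n r ∘L ContinuousLinearMap.proj s) ∘L
    (e.symm : (Fin m → sobolevSpace hab p n) →L[ℂ] (Fin m → sobolevSpace hab p n)),
    fun f => (he (e.symm f)).symm.trans (e.apply_symm_apply f)⟩

end Surjectivity

/-! ### Monomials as test functions -/

section TestFunctions

variable {a b : ℝ} {p : ℝ≥0∞} [Fact (1 ≤ p)] {q : ℕ}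

theorem isSobolev_one_fun (hab : a < b) : IsSobolev a b p q fun _ => 1 := by
  have h := ((isSobolev_zero_fun (p := p) (q := q) hab).const_add_primitive Fact.out hab 1).of_succ hab
  simpa using h

/-- The constant function `1` in `W_p^q`. -/
def oneFn (hab : a < b) (p : ℝ≥0∞) [Fact (1 ≤ p)] (q : ℕ) : sobolevSpace hab p q :=
  ofFun hab (fun _ => 1) (isSobolev_one_fun hab)

theorem oneFn_coord_zero_ae (hab : a < b) :
    (oneFn hab p q).1 0 =ᵐ[intervalMeasure a b] fun _ => 1 :=
  ofFun_ae _ _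

theorem oneFn_coord_of_pos (hab : a < b) (k : Fin (q + 1)) (hk : 0 < (k : ℕ)) :
    (oneFn hab p q).1 k = 0 := by
  have h : (oneFn hab p q).1 k =ᵐ[intervalMeasure a b]
      iteratedDerivWithin k (fun _ : ℝ => (1 : ℂ)) (Icc a b) :=
    MemLp.coeFn_toLp ((isSobolev_one_fun (q := q) hab).memLp_iteratedDeriv hab
      (Nat.le_of_lt_succ k.2))
  refine Lp.ext (h.trans (EventuallyEq.trans (Eventually.of_forall fun x => ?_)
    (Lp.coeFn_zero ℂ p _).symm))
  simp [iteratedDerivWithin_const, hk.ne']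

/-- The function `(x - a)^j / j!` in `W_p^q`. -/
def monomialFn (hab : a < b) (p : ℝ≥0∞) [Fact (1 ≤ p)] (q : ℕ) : ℕ → sobolevSpace hab p q
  | 0 => oneFn hab p q
  -- Here `iterDeriv 0` is the inclusion of `W_p^{q+1}` in `W_p^q`.
  | j + 1 => iterDeriv 0 (Nat.le_succ q) (integOp hab p q (monomialFn hab p q j))

theorem monomialFn_succ_coord (hab : a < b) (j k : ℕ) (hk : k + 1 < q + 1) :
    (monomialFn hab p q (j + 1)).1 ⟨k + 1, hk⟩ = (monomialFn hab p q j).1 ⟨k, by omega⟩ := rfl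

theorem monomialFn_coord_of_lt (hab : a < b) (j k : ℕ) (hk : k < q + 1) (hjk : j < k) :
    (monomialFn hab p q j).1 ⟨k, hk⟩ = 0 := by
  induction j generalizing k with
  | zero => exact oneFn_coord_of_pos hab _ hjk
  | succ j ih =>
    cases k with
    | zero => omega
    | succ k => rw [monomialFn_succ_coord]; exact ih k _ (by omega)

theorem monomialFn_coord_self_ae (hab : a < b) (j : ℕ) (hj : j < q + 1) :
    (monomialFn hab p q j).1 ⟨j, hj⟩ =ᵐ[intervalMeasure a b] fun _ => 1 := by
  induction j with
  | zero => exact oneFn_coord_zero_ae hab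
  | succ j ih => rw [monomialFn_succ_coord]; exact ih _

theorem iterDeriv_monomialFn_coord {q' : ℕ} (hab : a < b) (i j : ℕ) (h : q + i ≤ q') :
    (iterDeriv i h (monomialFn hab p q' j)).1 0 = (monomialFn hab p q' j).1 ⟨i, by omega⟩ := by
  have e : (⟨((0 : Fin (q + 1)) : ℕ) + i, by simp; omega⟩ : Fin (q' + 1)) = ⟨i, by omega⟩ := by
    ext; simp
  exact congrArg (monomialFn hab p q' j).1 e

theorem iterDeriv_monomialFn_of_lt {q' : ℕ} (hab : a < b) {i j : ℕ} (h : q + i ≤ q')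
    (hij : j < i) : iterDeriv i h (monomialFn hab p q' j) = 0 :=
  sobolevSpace_ext ((iterDeriv_monomialFn_coord hab i j h).trans
    (monomialFn_coord_of_lt hab j i _ hij))

theorem mulOp_iterDeriv_monomialFn {q' : ℕ} {hab : a < b} (A : sobolevSpace hab p q) (j : ℕ)
    (h : q + 1 + j ≤ q') : mulOp A (iterDeriv j h (monomialFn hab p q' j)) = A := by
  refine sobolevSpace_ext (Lp.ext ?_)
  have h1 := mulOp_ae A (iterDeriv j h (monomialFn hab p q' j))
  rw [iterDeriv_monomialFn_coord] at h1
  filter_upwards [h1, monomialFn_coord_self_ae (p := p) (q := q') hab j (by omega)] with x h1 h2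
  rw [h1, h2, mul_one]

end TestFunctions

/-! ### From strong convergence to convergence of coefficients -/

section Convergence

variable {a b : ℝ} {hab : a < b} {p : ℝ≥0∞} [Fact (1 ≤ p)] {n m r l : ℕ}

/-- The `j`-th derivative of the monomial is `1` and the higher ones vanish, including the leading
one since `j < r`. Testing thus isolates the coefficient of index `j` up to those of smaller index.
-/
theorem diffOp_single_monomialFn (A : Fin r → Matrix (Fin m) (Fin m) (sobolevSpace hab p n))
    (i s : Fin m) (j : Fin r) :
    diffOp A (Pi.single s (monomialFn hab p (n + r) j)) i = A j i s +
      ∑ j' ∈ Finset.Iio j, mulOp (A j' i s)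
        (iterDeriv (j' : ℕ) (show n + 1 + j' ≤ n + r by omega) (monomialFn hab p (n + r) j)) := by
  have h1 : iterDeriv (q := n) r le_rfl
      ((Pi.single s (monomialFn hab p (n + r) j) : Fin m → sobolevSpace hab p (n + r)) i) = 0 := by
    rcases eq_or_ne i s with rfl | h
    · rw [Pi.single_eq_same, iterDeriv_monomialFn_of_lt hab _ j.2]
    · rw [Pi.single_eq_of_ne h, map_zero]
  have h2 : ∀ j' : Fin r, ∑ s' : Fin m, mulOp (A j' i s')
        (iterDeriv (j' : ℕ) (show n + 1 + j' ≤ n + r by omega)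
        ((Pi.single s (monomialFn hab p (n + r) j) : Fin m → sobolevSpace hab p (n + r)) s')) =
      mulOp (A j' i s) (iterDeriv (j' : ℕ) (show n + 1 + j' ≤ n + r by omega)
        (monomialFn hab p (n + r) j)) := by
    intro j'
    rw [Finset.sum_eq_single s]
    · rw [Pi.single_eq_same]
    · intro s' _ hs
      rw [Pi.single_eq_of_ne hs, map_zero, map_zero]
    · simp
  rw [diffOp_apply, h1, zero_add, Finset.sum_congr rfl fun j' _ => h2 j',
    ← Finset.sum_subset (Finset.subset_univ (Finset.Iic j)), ← Finset.Iio_insert,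
    Finset.sum_insert (by simp), mulOp_iterDeriv_monomialFn]
  intro j' _ hj'
  rw [Finset.mem_Iic, not_le] at hj'
  rw [iterDeriv_monomialFn_of_lt hab _ hj', map_zero]

/-- Strong convergence of the differential operators implies convergence of their coefficients. -/
theorem tendsto_coeff {A : Fin r → Matrix (Fin m) (Fin m) (sobolevSpace hab p n)}
    {Ak : ℕ → Fin r → Matrix (Fin m) (Fin m) (sobolevSpace hab p n)}
    (h : ∀ y, Tendsto (fun k => diffOp (Ak k) y) atTop (𝓝 (diffOp A y))) :
    Tendsto Ak atTop (𝓝 A) := by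
  refine tendsto_pi_nhds.2 fun j => ?_
  induction j using WellFoundedLT.induction with
  | ind j ih =>
    refine tendsto_pi_nhds.2 fun i => tendsto_pi_nhds.2 fun s => ?_
    -- The triangular system solved for one entry. `mulFlip` exhibits the correction terms as
    -- continuous functions of the coefficients already known to converge.
    have e : ∀ A : Fin r → Matrix (Fin m) (Fin m) (sobolevSpace hab p n), A j i s =
        diffOp A (Pi.single s (monomialFn hab p (n + r) j)) i -
        ∑ j' ∈ Finset.Iio j, mulFlip (iterDeriv (j' : ℕ) (show n + 1 + j' ≤ n + r by omega)
          (monomialFn hab p (n + r) j)) (A j' i s) :=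
      fun A => eq_sub_of_add_eq (diffOp_single_monomialFn A i s j).symm
    rw [e A]
    refine Tendsto.congr (fun k => (e (Ak k)).symm) ?_
    refine Tendsto.sub (tendsto_pi_nhds.1 (h _) i) (tendsto_finsetSum _ fun j' hj' => ?_)
    have h2 := tendsto_pi_nhds.1 (tendsto_pi_nhds.1 (ih j' (Finset.mem_Iio.1 hj')) i) s
    exact ((continuous_mulFlip _).tendsto _).comp h2

theorem bvpOp_eq_prod (A : Fin r → Matrix (Fin m) (Fin m) (sobolevSpace hab p n))
    (B : (Fin m → sobolevSpace hab p (n + r)) →L[ℂ] (Fin l → ℂ)) :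
    bvpOp A B = ((diffOpL A).prod B).toLinearMap :=
  LinearMap.ext fun y => Prod.ext (diffOpL_apply A y).symm rfl

theorem eventually_dim_bvpOp_le
    {A : Fin r → Matrix (Fin m) (Fin m) (sobolevSpace hab p n)}
    {B : (Fin m → sobolevSpace hab p (n + r)) →L[ℂ] (Fin l → ℂ)}
    {Ak : ℕ → Fin r → Matrix (Fin m) (Fin m) (sobolevSpace hab p n)}
    {Bk : ℕ → (Fin m → sobolevSpace hab p (n + r)) →L[ℂ] (Fin l → ℂ)}
    (h : ∀ y, Tendsto (fun k => bvpOp (Ak k) (Bk k) y) atTop (𝓝 (bvpOp A B y))) :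
    ∀ᶠ k in atTop, dimKer (bvpOp (Ak k) (Bk k)) ≤ dimKer (bvpOp A B) ∧
      dimCoker (bvpOp (Ak k) (Bk k)) ≤ dimCoker (bvpOp A B) := by
  obtain ⟨R, hR⟩ := exists_rightInverse_diffOpL A
  have hA : Tendsto Ak atTop (𝓝 A) :=
    tendsto_coeff fun y => (continuous_fst.tendsto _).comp (h y)
  have hL : Tendsto (fun k => diffOpL (Ak k)) atTop (𝓝 (diffOpL A)) :=
    (continuous_diffOpL.tendsto A).comp hA
  have hB : ∀ y, Tendsto (fun k => Bk k y) atTop (𝓝 (B y)) := fun y =>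
    (continuous_snd.tendsto _).comp (h y)
  have key := eventually_dim_le (X := Fin m → sobolevSpace hab p (n + r))
    (Y := Fin m → sobolevSpace hab p n) (Z := Fin l → ℂ) hL hB R hR
  simp only [bvpOp_eq_prod]
  exact key

theorem isInvertibleOp_bvpOp_of_bijective
    (A : Fin r → Matrix (Fin m) (Fin m) (sobolevSpace hab p n))
    (B : (Fin m → sobolevSpace hab p (n + r)) →L[ℂ] (Fin l → ℂ))
    (h : Function.Bijective (bvpOp A B)) : IsInvertibleOp (bvpOp A B) := by
  rw [bvpOp_eq_prod] at h ⊢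
  exact isInvertibleOp_of_bijective (X := Fin m → sobolevSpace hab p (n + r))
    (Y := (Fin m → sobolevSpace hab p n) × (Fin l → ℂ)) ((diffOpL A).prod B) h

end Convergence

end SobolevBVP

end

theorem corollary2 {a b : ℝ} (hab : a < b) (p : ℝ≥0∞) [Fact (1 ≤ p)]
    (n m r l : ℕ) (hm : 1 ≤ m) (hr : 1 ≤ r) (hl : 1 ≤ l)
    -- the limit problem `L y = f`, `B y = c`
    (A : Fin r → Matrix (Fin m) (Fin m) (SobolevBVP.sobolevSpace hab p n))
    (B : (Fin m → SobolevBVP.sobolevSpace hab p (n + r)) →L[ℂ] (Fin l → ℂ))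
    -- the problems `L(k) y = f`, `B(k) y = c`
    (Ak : ℕ → Fin r → Matrix (Fin m) (Fin m) (SobolevBVP.sobolevSpace hab p n))
    (Bk : ℕ → (Fin m → SobolevBVP.sobolevSpace hab p (n + r)) →L[ℂ] (Fin l → ℂ))
    -- strong convergence of `(L(k), B(k))` to `(L, B)`
    (hconv : ∀ y : Fin m → SobolevBVP.sobolevSpace hab p (n + r),
      Tendsto (fun k => SobolevBVP.bvpOp (Ak k) (Bk k) y) atTop
        (𝓝 (SobolevBVP.bvpOp A B y))) :
    (∀ᶠ k in atTop, SobolevBVP.dimKer (SobolevBVP.bvpOp (Ak k) (Bk k)) ≤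
        SobolevBVP.dimKer (SobolevBVP.bvpOp A B)) ∧
    (∀ᶠ k in atTop, SobolevBVP.dimCoker (SobolevBVP.bvpOp (Ak k) (Bk k)) ≤
        SobolevBVP.dimCoker (SobolevBVP.bvpOp A B)) ∧
    -- invertibility is preserved
    (SobolevBVP.IsInvertibleOp (SobolevBVP.bvpOp A B) →
      ∀ᶠ k in atTop, SobolevBVP.IsInvertibleOp (SobolevBVP.bvpOp (Ak k) (Bk k))) ∧
    -- solvability for all right-hand sides is preserved
    ((∀ f c, ∃ y, SobolevBVP.bvpOp A B y = (f, c)) →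
      ∀ᶠ k in atTop, ∀ f c, ∃ y, SobolevBVP.bvpOp (Ak k) (Bk k) y = (f, c)) ∧
    -- uniqueness of solutions is preserved
    ((∃ f c, ∃! y, SobolevBVP.bvpOp A B y = (f, c)) →
      ∀ᶠ k in atTop, ∀ f c y z, SobolevBVP.bvpOp (Ak k) (Bk k) y = (f, c) →
        SobolevBVP.bvpOp (Ak k) (Bk k) z = (f, c) → y = z) ∧
    -- unique solvability for all right-hand sides is preserved
    ((∀ f c, ∃! y, SobolevBVP.bvpOp A B y = (f, c)) →
      ∀ᶠ k in atTop, ∀ f c, ∃! y, SobolevBVP.bvpOp (Ak k) (Bk k) y = (f, c)) := by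
  obtain ⟨hker, hcoker⟩ := eventually_and.1 (SobolevBVP.eventually_dim_bvpOp_le hconv)
  -- Injectivity and surjectivity mean that the kernel, respectively the cokernel, has dimension
  -- zero, and a dimension bounded by zero is zero.
  have hinj : Function.Injective (SobolevBVP.bvpOp A B) →
      ∀ᶠ k in atTop, Function.Injective (SobolevBVP.bvpOp (Ak k) (Bk k)) := fun h => by
    filter_upwards [hker] with k hk
    rw [← SobolevBVP.dimKer_eq_zero_iff] at h ⊢
    exact le_antisymm (hk.trans h.le) zero_le
  have hsurj : Function.Surjective (SobolevBVP.bvpOp A B) →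
      ∀ᶠ k in atTop, Function.Surjective (SobolevBVP.bvpOp (Ak k) (Bk k)) := fun h => by
    filter_upwards [hcoker] with k hk
    rw [← SobolevBVP.dimCoker_eq_zero_iff] at h ⊢
    exact le_antisymm (hk.trans h.le) zero_le
  refine ⟨hker, hcoker, ?_, ?_, ?_, ?_⟩
  · rintro ⟨e, he⟩
    have h : Function.Bijective (SobolevBVP.bvpOp A B) := by
      rw [← show ⇑e = ⇑(SobolevBVP.bvpOp A B) from funext he]
      exact e.bijective
    filter_upwards [hinj h.1, hsurj h.2] with k h1 h2
    exact SobolevBVP.isInvertibleOp_bvpOp_of_bijective _ _ ⟨h1, h2⟩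
  · intro h
    filter_upwards [hsurj fun z => h z.1 z.2] with k hk f c
    exact hk (f, c)
  · rintro ⟨f, c, y, hy, huniq⟩
    have h : Function.Injective (SobolevBVP.bvpOp A B) := by
      rw [injective_iff_map_eq_zero]
      intro z hz
      -- Adding a kernel element to the unique solution gives another solution, so a single uniquely
      -- solvable right-hand side forces a trivial kernel.
      have h1 := huniq (y + z) (by
        change SobolevBVP.bvpOp A B (y + z) = (f, c)
        rw [map_add, hz, add_zero]
        exact hy)
      exact add_eq_left.1 h1
    filter_upwards [hinj h] with k hk f c y z h1 h2
    exact hk (h1.trans h2.symm)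
  · intro h
    have h' : Function.Bijective (SobolevBVP.bvpOp A B) :=
      Function.bijective_iff_existsUnique _ |>.2 fun z => h z.1 z.2
    filter_upwards [hinj h'.1, hsurj h'.2] with k h1 h2 f c
    exact (Function.bijective_iff_existsUnique _).1 ⟨h1, h2⟩ (f, c)
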